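/- **Theorem.** Let $\mu>0$ and let $n\ge 1$ be an integer. Let $W,P,R$ be independent random variables such that $P$ has the Erlang distribution with $n$ stages of rate $\mu$, i.e. $$\mathbb P[P\le x]=G(x)=1-e^{-\mu x}\sum_{j=0}^{n-1}\frac{(\mu x)^j}{j!}\quad(x\ge 0),$$ $R$ is uniformly distributed on $[0,1)$, and $W\stackrel{d}{=}(R-P-W)^+$, where $(x)^+=\max\{0,x\}$ (so $W$ is the stationary waiting time of $W_{k+1}=(R_{k+1}-P_k-W_k)^+$). Put $\pi_0=\mathbb P[W=0]$. The polynomial $R(s)=s^2(\mu^2-s^2)^n+\mu^{2n}$ has exactly $2n+2$ zeros in $\mathbb C$, all nonzero and simple; they can be numbered $r_1,\dots,r_{2n+2}$ with $r_{2n+3-i}=-r_i$. The law of $W$ consists of the atom $\pi_0$ at $0$ and a part on $[0,1]$ with a continuous density $f\ge 0$ with respect to Lebesgue measure. Let $\phi(s)=\int_0^1 e^{-sx}f(x)\,dx$. For $p\in\mathbb C$ and $y=(y_0,\dots,y_{n-1})\in\mathbb C^n$ put $$A_{p,y}(s)=p\Big(\mu^n+e^{-(\mu+s)}\sum_{j=0}^{n-1}\sum_{i=0}^{j}\frac{s\mu^j(\mu+s)^{n-j-1+i}}{i!}\Big)-e^{-s}(\mu+s)^n+e^{-(\mu+s)}\sum_{j=0}^{n-1}\sum_{i=0}^{j}\sum_{\ell=0}^{i}\binom{i}{\ell}\frac{s\mu^j(\mu+s)^{n-j-1+i}}{i!}\,y_\ell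 ,$$ let $A=A_{p,y}$ with $p=\pi_0$ and $y_\ell=\phi^{(\ell)}(-\mu)$, and let $P(s)$, $Q(s)$ be the polynomials obtained by collecting the terms without and with $e^{-s}$ in $$-e^{-s}s(\mu+s)^nA(-s)-\mu^nA(s)=P(s)+e^{-s}Q(s),$$ that is, $$P(s)=-s(\mu+s)^nB(-s)-\mu^{2n}\pi_0,\qquad B(s)=e^{-\mu}\sum_{j=0}^{n-1}\sum_{i=0}^{j}\frac{s\mu^j(\mu+s)^{n-j-1+i}}{i!}\Big(\pi_0+\sum_{\ell=0}^{i}\binom{i}{\ell}\phi^{(\ell)}(-\mu)\Big)-(\mu+s)^n .$$ Put $c_i=P(r_i)/R'(r_i)$. Then, for every such numbering of the zeros, $$f(x)=\sum_{i=1}^{2n+2}c_ie^{r_ix}\quad(0\le x\le 1),\qquad \pi_0=\mathbb P[W=0]=1+\sum_{i=1}^{2n+2}\frac{c_i}{r_i}\,(1-e^{r_i}).$$ The constants $\pi_0,\phi(-\mu),\dots,\phi^{(n-1)}(-\mu)$ that enter the $c_i$ are the unique solution $(p,y_0,\dots,y_{n-1})\in\mathbb C^{n+1}$ of the $n+1$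 linear equations $$e^{-r_i}r_i(\mu+r_i)^nA_{p,y}(-r_i)+\mu^nA_{p,y}(r_i)=0,\qquad i=1,\dots,n+1 .$$ -/

import Mathlib

open MeasureTheory ProbabilityTheory

namespace Carousel

noncomputable section

/-- The distribution function on `[0, ∞)` of the Erlang distribution with `n` stages, each of
rate `μ`. -/
def erlangCDF (μ : ℝ) (n : ℕ) (x : ℝ) : ℝ :=
  1 - Real.exp (-μ * x) * ∑ j ∈ Finset.range n, (μ * x) ^ j / (Nat.factorial j : ℝ)

/-- `W` is a stationary waiting time for pick time `P` and rotation time `R`: the three random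
variables are independent, `P` is Erlang with `n` stages of rate `μ`, `R` is uniform on `[0, 1)`,
and `W` has the same law as `(R - P - W)⁺`. -/
structure IsStationaryWaitingTime {Ω : Type*} [MeasurableSpace Ω] (Pr : Measure Ω)
    (μ : ℝ) (n : ℕ) (W P R : Ω → ℝ) : Prop where
  measurable_W : Measurable W
  measurable_P : Measurable P
  measurable_R : Measurable R
  indep : iIndepFun ![W, P, R] Pr
  erlang : ∀ x : ℝ, 0 ≤ x → Pr.real {ω | P ω ≤ x} = erlangCDF μ n x
  uniform : pdf.IsUniform R (Set.Ico 0 1) Pr volume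
  stationary : IdentDistrib W (fun ω => max 0 (R ω - P ω - W ω)) Pr Pr

/-- `f` is the (continuous) density of `W` on `[0, 1]`: the law of `W` consists of an atom at `0`
of mass `Pr[W = 0]` and of a part on `[0, 1]` with Lebesgue density `f`. -/
structure IsDensityOnUnitInterval {Ω : Type*} [MeasurableSpace Ω] (Pr : Measure Ω)
    (W : Ω → ℝ) (f : ℝ → ℝ) : Prop where
  continuousOn : ContinuousOn f (Set.Icc 0 1)
  nonneg : ∀ x ∈ Set.Icc (0 : ℝ) 1, 0 ≤ f x
  law_eq : Pr.map W = Pr {ω | W ω = 0} • Measure.dirac (0 : ℝ)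
    + (volume.restrict (Set.Icc (0 : ℝ) 1)).withDensity (fun x => ENNReal.ofReal (f x))

/-- The Laplace transform `φ(s) = ∫₀¹ e^{-s x} f(x) dx` over `[0, 1]`. -/
def unitLaplace (f : ℝ → ℝ) (s : ℂ) : ℂ :=
  ∫ x in (0 : ℝ)..1, Complex.exp (-s * (x : ℂ)) * (f x : ℂ)

/-- The polynomial `R(s) = s² (μ² - s²)ⁿ + μ²ⁿ`. -/
def polyR (μ : ℝ) (n : ℕ) : Polynomial ℂ :=
  Polynomial.X ^ 2 * (Polynomial.C ((μ : ℂ) ^ 2) - Polynomial.X ^ 2) ^ n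
    + Polynomial.C ((μ : ℂ) ^ (2 * n))

/-- The function `A(s)`, with `p` in the place of `π₀` and `y ℓ` in the place of the `ℓ`-th
derivative `φ^{(ℓ)}(-μ)`; only `y 0, …, y (n - 1)` occur. -/
def funA (μ : ℝ) (n : ℕ) (p : ℂ) (y : ℕ → ℂ) (s : ℂ) : ℂ :=
  p * ((μ : ℂ) ^ n + Complex.exp (-((μ : ℂ) + s)) *
      ∑ j ∈ Finset.range n, ∑ i ∈ Finset.range (j + 1),
        s * (μ : ℂ) ^ j * ((μ : ℂ) + s) ^ (n - 1 - j + i) / (Nat.factorial i : ℂ))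
    - Complex.exp (-s) * ((μ : ℂ) + s) ^ n
    + Complex.exp (-((μ : ℂ) + s)) *
      ∑ j ∈ Finset.range n, ∑ i ∈ Finset.range (j + 1), ∑ l ∈ Finset.range (i + 1),
        (Nat.choose i l : ℂ) *
          (s * (μ : ℂ) ^ j * ((μ : ℂ) + s) ^ (n - 1 - j + i) / (Nat.factorial i : ℂ)) * y l

/-- The polynomial `B` with `A(s) = p μⁿ + e^{-s} B(s)`. -/
def polyB (μ : ℝ) (n : ℕ) (p : ℂ) (y : ℕ → ℂ) : Polynomial ℂ :=
  Polynomial.C (Complex.exp (-(μ : ℂ))) *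
      (∑ j ∈ Finset.range n, ∑ i ∈ Finset.range (j + 1),
        Polynomial.C ((μ : ℂ) ^ j / (Nat.factorial i : ℂ) *
            (p + ∑ l ∈ Finset.range (i + 1), (Nat.choose i l : ℂ) * y l)) *
          (Polynomial.X * (Polynomial.C (μ : ℂ) + Polynomial.X) ^ (n - 1 - j + i)))
    - (Polynomial.C (μ : ℂ) + Polynomial.X) ^ n

/-- The polynomial `P(s)`: the terms without `e^{-s}` in
`-e^{-s} s (μ + s)ⁿ A(-s) - μⁿ A(s) = P(s) + e^{-s} Q(s)`. -/
def polyP (μ : ℝ) (n : ℕ) (p : ℂ) (y : ℕ → ℂ) : Polynomial ℂ :=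
  -(Polynomial.X * (Polynomial.C (μ : ℂ) + Polynomial.X) ^ n *
      (polyB μ n p y).comp (-Polynomial.X))
    - Polynomial.C ((μ : ℂ) ^ (2 * n) * p)

/-- The polynomial `Q(s)`: the coefficient of `e^{-s}` in
`-e^{-s} s (μ + s)ⁿ A(-s) - μⁿ A(s) = P(s) + e^{-s} Q(s)`. -/
def polyQ (μ : ℝ) (n : ℕ) (p : ℂ) (y : ℕ → ℂ) : Polynomial ℂ :=
  -(Polynomial.C ((μ : ℂ) ^ n * p) *
      (Polynomial.X * (Polynomial.C (μ : ℂ) + Polynomial.X) ^ n))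
    - Polynomial.C ((μ : ℂ) ^ n) * polyB μ n p y

theorem funA_eq (μ : ℝ) (n : ℕ) (p : ℂ) (y : ℕ → ℂ) (s : ℂ) :
    funA μ n p y s = p * (μ : ℂ) ^ n + Complex.exp (-s) * (polyB μ n p y).eval s := by
  have h : Complex.exp (-((μ : ℂ) + s)) = Complex.exp (-s) * Complex.exp (-(μ : ℂ)) := by
    rw [← Complex.exp_add]; congr 1; ring
  have h2 : ((∑ j ∈ Finset.range n, ∑ i ∈ Finset.range (j + 1),
        Polynomial.C ((μ : ℂ) ^ j / (Nat.factorial i : ℂ) *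
            (p + ∑ l ∈ Finset.range (i + 1), (Nat.choose i l : ℂ) * y l)) *
          (Polynomial.X * (Polynomial.C (μ : ℂ) + Polynomial.X) ^ (n - 1 - j + i))).eval s)
      = p * (∑ j ∈ Finset.range n, ∑ i ∈ Finset.range (j + 1),
        s * (μ : ℂ) ^ j * ((μ : ℂ) + s) ^ (n - 1 - j + i) / (Nat.factorial i : ℂ))
      + ∑ j ∈ Finset.range n, ∑ i ∈ Finset.range (j + 1), ∑ l ∈ Finset.range (i + 1),
        (Nat.choose i l : ℂ) *
          (s * (μ : ℂ) ^ j * ((μ : ℂ) + s) ^ (n - 1 - j + i) / (Nat.factorial i : ℂ)) * y l := by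
    simp only [Polynomial.eval_finsetSum, Finset.mul_sum, ← Finset.sum_add_distrib]
    refine Finset.sum_congr rfl fun j _ => Finset.sum_congr rfl fun i _ => ?_
    have h3 : ∑ l ∈ Finset.range (i + 1), (Nat.choose i l : ℂ) *
          (s * (μ : ℂ) ^ j * ((μ : ℂ) + s) ^ (n - 1 - j + i) / (Nat.factorial i : ℂ)) * y l
        = (s * (μ : ℂ) ^ j * ((μ : ℂ) + s) ^ (n - 1 - j + i) / (Nat.factorial i : ℂ)) *
          ∑ l ∈ Finset.range (i + 1), (Nat.choose i l : ℂ) * y l := by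
      rw [Finset.mul_sum]; exact Finset.sum_congr rfl fun l _ => by ring
    rw [h3]
    simp only [Polynomial.eval_mul, Polynomial.eval_C, Polynomial.eval_X, Polynomial.eval_pow,
      Polynomial.eval_add]
    ring
  simp only [funA, polyB, Polynomial.eval_sub, Polynomial.eval_mul, Polynomial.eval_C, h2, h,
    Polynomial.eval_pow, Polynomial.eval_add, Polynomial.eval_X]
  ring

/-- `P` and `Q` are indeed what one gets by collecting the terms with and without `e^{-s}`. -/
theorem polyP_add_polyQ (μ : ℝ) (n : ℕ) (p : ℂ) (y : ℕ → ℂ) (s : ℂ) :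
    -(Complex.exp (-s) * s * ((μ : ℂ) + s) ^ n * funA μ n p y (-s))
        - (μ : ℂ) ^ n * funA μ n p y s
      = (polyP μ n p y).eval s + Complex.exp (-s) * (polyQ μ n p y).eval s := by
  have h : Complex.exp (-s) * Complex.exp s = 1 := by rw [← Complex.exp_add]; simp
  simp only [funA_eq, polyP, polyQ, Polynomial.eval_sub, Polynomial.eval_neg, Polynomial.eval_mul,
    Polynomial.eval_C, Polynomial.eval_X, Polynomial.eval_pow, Polynomial.eval_add,
    Polynomial.eval_comp, neg_neg]
  linear_combination (-(s * ((μ : ℂ) + s) ^ n * (polyB μ n p y).eval (-s))) * h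

/-- `r` lists the zeros of `R` without repetition, in an order in which companion zeros `s` and
`-s` occupy mirror positions; in particular `R` has exactly `2n + 2` distinct zeros. -/
structure IsZeroEnumeration (μ : ℝ) (n : ℕ) (r : Fin (2 * n + 2) → ℂ) : Prop where
  injective : Function.Injective r
  range_eq : Set.range r = {s : ℂ | (polyR μ n).eval s = 0}
  companion : ∀ i, r i.rev = -r i

/-- The coefficient `c = P(r) / R'(r)` that belongs to a zero `r` of `R`. -/
def coeffC (μ : ℝ) (n : ℕ) (p : ℂ) (y : ℕ → ℂ) (r : ℂ) : ℂ :=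
  (polyP μ n p y).eval r / (polyR μ n).derivative.eval r

end

end Carousel

namespace Carousel

noncomputable section

/-! Since `R` is uniform, the law of `R - P - W` on `(0, 1]` has density `f(x) = Pr[P + W ≤ 1 - x]`.
Splitting the law of `W` into atom and density turns this into the integral equation `f(1 - t) = π₀
G(t) + ∫₀¹ G(t - y) f(y) dy`, with `π₀ + ∫ f = 1` (`IsStationarySolution`).

The Laplace transform over `[0, 1]` gives `s (μ + s)ⁿ e^{-s} φ(-s) - μⁿ φ(s) = A(s)`; the truncated
Erlang transform produces the moments `∫ (1 - y)^i e^{μ y} f(y) dy`, which are combinations of the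
derivatives of `φ` at `-μ` (`lap_erlangConv_eq`). Using this at `s` and at `-s` eliminates `φ(-s)`
and leaves `R(s) φ(s) = P(s) + e^{-s} Q(s)`. Because `φ` is finite everywhere, the right-hand side
vanishes at each `r_i`. Partial fractions over the simple zeros then exhibit `φ` as the transform of
`∑ c_i e^{r_i x}` (`lap_expSum_eq`), and the transform is injective on continuous functions
(`eq_zero_of_lap_eq_zero`). The formula for `π₀` is total mass one.

For uniqueness, a solution of the `n + 1` equations satisfies them at all zeros (`linSys_neg`). Its
exponential sum then solves the integral equation: the transform of the defect, times `e^s s (μ +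
s)ⁿ`, is a polynomial of degree at most `n`, hence zero (`isStationarySolution_expSum`). The
integral equation itself has only one solution, by a contraction estimate with factor `1 - e^{-μ}`
(`eq_zero_of_erlangConv`). -/

/-! ### The polynomial `R` and the simplicity of its zeros -/

theorem polyR_eval (μ : ℝ) (n : ℕ) (s : ℂ) :
    (polyR μ n).eval s = s ^ 2 * ((μ : ℂ) ^ 2 - s ^ 2) ^ n + (μ : ℂ) ^ (2 * n) := by
  simp [polyR]

theorem polyR_eval_neg (μ : ℝ) (n : ℕ) (s : ℂ) :
    (polyR μ n).eval (-s) = (polyR μ n).eval s := by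
  simp [polyR_eval]

theorem polyR_derivative_eval (μ : ℝ) (n : ℕ) (s : ℂ) :
    (polyR μ (n + 1)).derivative.eval s
      = 2 * s * ((μ : ℂ) ^ 2 - s ^ 2) ^ n * ((μ : ℂ) ^ 2 - (n + 2) * s ^ 2) := by
  simp [polyR, Polynomial.derivative_pow]
  ring

theorem polyR_natDegree (μ : ℝ) (n : ℕ) : (polyR μ n).natDegree = 2 * n + 2 := by
  have h1 : (Polynomial.C ((μ : ℂ) ^ 2) - Polynomial.X ^ 2 : Polynomial ℂ).natDegree = 2 := by
    compute_degree!
  have h0 : (Polynomial.C ((μ : ℂ) ^ 2) - Polynomial.X ^ 2 : Polynomial ℂ) ≠ 0 := by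
    intro h; rw [h] at h1; simp at h1
  rw [polyR, Polynomial.natDegree_add_C, Polynomial.natDegree_mul (by simp) (pow_ne_zero _ h0),
    Polynomial.natDegree_pow, Polynomial.natDegree_pow, h1, Polynomial.natDegree_X]
  ring

theorem polyR_ne_zero (μ : ℝ) (n : ℕ) : polyR μ n ≠ 0 := by
  intro h
  have := polyR_natDegree μ n
  rw [h] at this; simp at this

theorem polyR_root_ne_zero {μ : ℝ} (hμ : 0 < μ) {n : ℕ} {s : ℂ}
    (hs : (polyR μ n).eval s = 0) : s ≠ 0 := by
  rintro rfl
  rw [polyR_eval] at hs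
  simp [hμ.ne'] at hs

/-- The critical points are `s = 0`, `s² = μ²` and `s² = μ² / (n + 1)`. In the first two cases `R`
equals `μ²ⁿ`; in the third it is a nonnegative real plus `μ²ⁿ`. So no critical point is a zero. -/
theorem polyR_derivative_ne_zero {μ : ℝ} (hμ : 0 < μ) {n : ℕ} (hn : 1 ≤ n) {s : ℂ}
    (hs : (polyR μ n).eval s = 0) : (polyR μ n).derivative.eval s ≠ 0 := by
  obtain ⟨m, rfl⟩ : ∃ m, n = m + 1 := ⟨n - 1, by omega⟩
  have hμ' : (μ : ℂ) ≠ 0 := by exact_mod_cast hμ.ne'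
  have h0 := polyR_root_ne_zero hμ hs
  rw [polyR_eval] at hs
  rw [polyR_derivative_eval]
  refine mul_ne_zero (mul_ne_zero (mul_ne_zero two_ne_zero h0) (pow_ne_zero _ ?_)) ?_
  · intro h
    rw [h] at hs
    simp [hμ'] at hs
  · intro h
    have hm : ((m : ℂ) + 2) ≠ 0 := by exact_mod_cast (by omega : m + 2 ≠ 0)
    have h2 : s ^ 2 = ((μ ^ 2 / (m + 2) : ℝ) : ℂ) := by
      push_cast
      rw [eq_div_iff hm]; linear_combination -h
    rw [h2] at hs
    have h3 : μ ^ 2 / (m + 2) * (μ ^ 2 - μ ^ 2 / (m + 2)) ^ (m + 1) + μ ^ (2 * (m + 1)) = 0 := by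
      exact_mod_cast hs
    have h4 : 0 ≤ μ ^ 2 - μ ^ 2 / ((m : ℝ) + 2) := by
      rw [sub_nonneg]
      exact div_le_self (by positivity) (by linarith [Nat.cast_nonneg (α := ℝ) m])
    have h5 : 0 < μ ^ (2 * (m + 1)) := by positivity
    have h6 : 0 ≤ μ ^ 2 / ((m : ℝ) + 2) * (μ ^ 2 - μ ^ 2 / (m + 2)) ^ (m + 1) := by positivity
    linarith

theorem polyR_card_roots {μ : ℝ} (hμ : 0 < μ) {n : ℕ} (hn : 1 ≤ n) :
    (polyR μ n).roots.toFinset.card = 2 * n + 2 := by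
  have h1 : (polyR μ n).roots.Nodup := by
    rw [Multiset.nodup_iff_count_le_one]
    intro a
    rw [Polynomial.count_roots]
    by_contra! h
    have := (Polynomial.one_lt_rootMultiplicity_iff_isRoot (polyR_ne_zero μ n)).1 h
    exact polyR_derivative_ne_zero hμ hn this.1 this.2
  rw [Multiset.toFinset_card_of_nodup h1, IsAlgClosed.card_roots_eq_natDegree, polyR_natDegree]

/-! ### Enumeration of the zeros, partial fractions and degree bounds -/

/-- A set of `2 * m` nonzero complex numbers that is closed under negation can be listed so that
opposite numbers occupy mirror positions. -/
theorem exists_enumeration_of_neg_mem (S : Finset ℂ) (m : ℕ) (hS : S.card = 2 * m)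
    (h0 : (0 : ℂ) ∉ S) (hneg : ∀ s ∈ S, -s ∈ S) :
    ∃ r : Fin (2 * m) → ℂ, Function.Injective r ∧ Set.range r = S ∧ ∀ i, r i.rev = -r i := by
  classical
  -- The open right half-plane together with the positive imaginary axis contains exactly one of `s`
  -- and `-s` for each `s ≠ 0`.
  let p : ℂ → Prop := fun s => 0 < s.re ∨ (s.re = 0 ∧ 0 < s.im)
  have hp1 : ∀ s, p s → ¬ p (-s) := by
    rintro s (h | ⟨h, h'⟩) (h2 | ⟨h2, h2'⟩) <;> simp at h2 <;> try linarith
    simp at h2'; linarith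
  have hp2 : ∀ s, s ≠ 0 → ¬ p s → p (-s) := by
    intro s hs h
    simp only [p, not_or, not_lt, not_and] at h
    rcases lt_or_eq_of_le h.1 with h1 | h1
    · left; simpa using h1
    · right
      refine ⟨by simpa using h1, ?_⟩
      have := h.2 h1
      rcases lt_or_eq_of_le this with h3 | h3
      · simpa using h3
      · exact absurd (Complex.ext h1 h3) hs
  have hcard : (S.filter p).card = m := by
    have h1 : (S.filter (fun s => ¬ p s)).card = (S.filter p).card := by
      refine Finset.card_bij' (fun s _ => -s) (fun s _ => -s) ?_ ?_ ?_ ?_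
      · intro s hs
        rw [Finset.mem_filter] at hs ⊢
        exact ⟨hneg s hs.1, hp2 s (fun h => h0 (h ▸ hs.1)) hs.2⟩
      · intro s hs
        rw [Finset.mem_filter] at hs ⊢
        exact ⟨hneg s hs.1, hp1 s hs.2⟩
      · simp
      · simp
    have h2 := Finset.card_filter_add_card_filter_not (s := S) p
    omega
  let e := (S.filter p).equivFinOfCardEq hcard
  let e' : Fin m → ℂ := fun i => (e.symm i : ℂ)
  have he' : ∀ i, e' i ∈ S ∧ p (e' i) := fun i => Finset.mem_filter.1 (e.symm i).2
  have he'inj : Function.Injective e' := fun i j h => e.symm.injective (Subtype.ext h)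
  -- The second half lists the negatives in reverse order, so that index `2 * m - 1 - i` mirrors
  -- `i`.
  let r : Fin (2 * m) → ℂ := fun i =>
    if h : (i : ℕ) < m then e' ⟨i, h⟩ else -e' ⟨2 * m - 1 - i, by omega⟩
  have hmem : ∀ i, r i ∈ S := by
    intro i
    by_cases h : (i : ℕ) < m
    · simp only [r, h, dif_pos]; exact (he' _).1
    · simp only [r, h, dif_neg, not_false_eq_true]; exact hneg _ (he' _).1
  have hinj : Function.Injective r := by
    intro i j hij
    by_cases h : (i : ℕ) < m <;> by_cases h' : (j : ℕ) < m <;>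
      simp only [r, h, h', dif_pos, dif_neg, not_false_eq_true] at hij
    · have := congrArg Fin.val (he'inj hij); exact Fin.ext this
    · exact absurd ((he' ⟨i, h⟩).2) (by rw [hij]; exact hp1 _ (he' _).2)
    · exact absurd ((he' ⟨j, h'⟩).2) (by rw [← hij]; exact hp1 _ (he' _).2)
    · have := congrArg Fin.val (he'inj (neg_injective hij))
      simp only at this
      exact Fin.ext (by omega)
  refine ⟨r, hinj, ?_, ?_⟩
  · have h1 : Finset.univ.image r = S := by
      refine Finset.eq_of_subset_of_card_le ?_ ?_
      · intro s hs
        obtain ⟨i, -, rfl⟩ := Finset.mem_image.1 hs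
        exact hmem i
      · rw [Finset.card_image_of_injective _ hinj, hS]; simp
    rw [← h1]; simp
  · intro i
    by_cases h : (i : ℕ) < m
    · have h2 : ¬ ((i.rev : Fin (2 * m)) : ℕ) < m := by rw [Fin.val_rev]; omega
      simp only [r, h, h2, dif_pos, dif_neg, not_false_eq_true]
      congr 3
      rw [Fin.val_rev]; omega
    · have h2 : ((i.rev : Fin (2 * m)) : ℕ) < m := by rw [Fin.val_rev]; omega
      simp only [r, h, h2, dif_pos, dif_neg, not_false_eq_true, neg_neg]
      congr 2
      rw [Fin.val_rev]; omega

theorem exists_isZeroEnumeration {μ : ℝ} (hμ : 0 < μ) {n : ℕ} (hn : 1 ≤ n) :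
    ∃ r : Fin (2 * n + 2) → ℂ, IsZeroEnumeration μ n r := by
  obtain ⟨r, h1, h2, h3⟩ := exists_enumeration_of_neg_mem (polyR μ n).roots.toFinset (n + 1)
    (polyR_card_roots hμ hn)
    (fun h => polyR_root_ne_zero hμ (n := n) (s := 0) (by simpa [polyR_ne_zero] using h) rfl)
    (fun s hs => by
      simp only [Multiset.mem_toFinset, Polynomial.mem_roots', Polynomial.IsRoot.def] at hs ⊢
      rwa [polyR_eval_neg])
  refine ⟨r, h1, ?_, h3⟩
  rw [h2]
  ext s
  simp [polyR_ne_zero]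

theorem IsZeroEnumeration.eval_eq_zero {μ : ℝ} {n : ℕ} {r : Fin (2 * n + 2) → ℂ}
    (hr : IsZeroEnumeration μ n r) (i) : (polyR μ n).eval (r i) = 0 := by
  have : r i ∈ Set.range r := ⟨i, rfl⟩
  rwa [hr.range_eq] at this

/-- The coprime factors `X - r_i` all divide `R`, and there are as many of them as its degree, so
the quotient is constant. -/
theorem IsZeroEnumeration.polyR_eq {μ : ℝ} {n : ℕ} {r : Fin (2 * n + 2) → ℂ}
    (hr : IsZeroEnumeration μ n r) :
    polyR μ n = Polynomial.C (polyR μ n).leadingCoeff * Lagrange.nodal Finset.univ r := by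
  have hdvd : Lagrange.nodal Finset.univ r ∣ polyR μ n := by
    rw [Lagrange.nodal]
    refine Finset.prod_dvd_of_coprime ?_ ?_
    · intro i _ j _ hij
      exact Polynomial.pairwise_coprime_X_sub_C hr.injective hij
    · intro i _
      rw [Polynomial.dvd_iff_isRoot]
      exact hr.eval_eq_zero i
  obtain ⟨q, hq⟩ := hdvd
  have hmon : (Lagrange.nodal Finset.univ r).Monic := Lagrange.nodal_monic
  have hdeg := polyR_natDegree μ n
  have hq0 : q ≠ 0 := by rintro rfl; exact polyR_ne_zero μ n (by simpa using hq)
  rw [hq, hmon.natDegree_mul' hq0, Lagrange.natDegree_nodal] at hdeg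
  have hq1 : q.natDegree = 0 := by simp at hdeg; omega
  obtain ⟨c, rfl⟩ := Polynomial.natDegree_eq_zero.1 hq1
  conv_lhs => rw [hq]
  rw [hq, Polynomial.leadingCoeff_mul, hmon.leadingCoeff, Polynomial.leadingCoeff_C, one_mul,
    mul_comm]

/-- Partial fractions with respect to the simple zeros of `polyR`. -/
theorem IsZeroEnumeration.eval_eq_sum {μ : ℝ} {n : ℕ}
    {r : Fin (2 * n + 2) → ℂ} (hr : IsZeroEnumeration μ n r) (q : Polynomial ℂ)
    (hq : q.degree < ((2 * n + 2 : ℕ) : WithBot ℕ)) (s : ℂ) (hs : (polyR μ n).eval s ≠ 0) :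
    q.eval s = (polyR μ n).eval s *
      ∑ i, q.eval (r i) / (polyR μ n).derivative.eval (r i) / (s - r i) := by
  -- Having degree below the number of nodes, `q` is its own Lagrange interpolant. The barycentric
  -- form of the interpolant is the partial fraction expansion, with nodal weights equal to
  -- reciprocals of the derivative of the nodal polynomial.
  have h1 : q = Lagrange.interpolate Finset.univ r (fun i => q.eval (r i)) :=
    Lagrange.eq_interpolate (hr.injective.injOn) (by simpa using hq)
  have hR := hr.polyR_eq
  set a := (polyR μ n).leadingCoeff with ha
  have hsr : ∀ i ∈ Finset.univ, s ≠ r i := by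
    rintro i - rfl
    exact hs (hr.eval_eq_zero i)
  have ha0 : a ≠ 0 := by simpa [ha] using polyR_ne_zero μ n
  conv_lhs => rw [h1, Lagrange.eval_interpolate_not_at_node _ hsr]
  rw [hR, Polynomial.eval_mul, Polynomial.eval_C, Polynomial.derivative_C_mul,
    mul_comm a, mul_assoc]
  congr 1
  rw [Finset.mul_sum]
  refine Finset.sum_congr rfl fun i hi => ?_
  rw [Lagrange.nodalWeight_eq_eval_derivative_nodal hi, Polynomial.eval_mul, Polynomial.eval_C]
  field_simp

theorem natDegree_C_add_X_pow_le (a : ℂ) (k : ℕ) :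
    ((Polynomial.C a + Polynomial.X) ^ k).natDegree ≤ k :=
  Polynomial.natDegree_pow_le.trans (by
    have : (Polynomial.C a + Polynomial.X).natDegree ≤ 1 := by compute_degree
    nlinarith)

/-- From `i ≤ j ≤ n - 1` the exponent `n - 1 - j + i` is at most `n - 1`, and the factor `X` adds
one. Consequently `P` and `Q` have smaller degree than `R`, as partial fractions require. -/
theorem polyB_natDegree_le (μ : ℝ) (n : ℕ) (p : ℂ) (y : ℕ → ℂ) :
    (polyB μ n p y).natDegree ≤ n := by
  have hX := natDegree_C_add_X_pow_le (μ : ℂ)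
  refine (Polynomial.natDegree_sub_le _ _).trans (max_le ?_ (hX n))
  refine (Polynomial.natDegree_C_mul_le _ _).trans ?_
  refine Polynomial.natDegree_sum_le_of_forall_le (Finset.range n) _ fun j hj => ?_
  refine Polynomial.natDegree_sum_le_of_forall_le (Finset.range (j + 1)) _ fun i hi => ?_
  rw [Finset.mem_range] at hi hj
  refine (Polynomial.natDegree_C_mul_le _ _).trans ?_
  refine Polynomial.natDegree_mul_le.trans ?_
  have := hX (n - 1 - j + i)
  have := Polynomial.natDegree_X_le (R := ℂ)
  omega

theorem polyP_natDegree_lt (μ : ℝ) (n : ℕ) (p : ℂ) (y : ℕ → ℂ) :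
    (polyP μ n p y).natDegree < 2 * n + 2 := by
  have hX := natDegree_C_add_X_pow_le (μ : ℂ) n
  have hB : ((polyB μ n p y).comp (-Polynomial.X)).natDegree ≤ n := by
    refine Polynomial.natDegree_comp_le.trans ?_
    rw [Polynomial.natDegree_neg, Polynomial.natDegree_X, mul_one]
    exact polyB_natDegree_le μ n p y
  rw [polyP, Polynomial.natDegree_sub_C, Polynomial.natDegree_neg]
  refine lt_of_le_of_lt Polynomial.natDegree_mul_le ?_
  have h1 := Polynomial.natDegree_mul_le (p := (Polynomial.X : Polynomial ℂ))
    (q := (Polynomial.C (μ : ℂ) + Polynomial.X) ^ n)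
  have := Polynomial.natDegree_X_le (R := ℂ)
  omega

theorem polyQ_natDegree_lt (μ : ℝ) (n : ℕ) (p : ℂ) (y : ℕ → ℂ) :
    (polyQ μ n p y).natDegree < 2 * n + 2 := by
  have hX := natDegree_C_add_X_pow_le (μ : ℂ) n
  refine lt_of_le_of_lt (Polynomial.natDegree_sub_le _ _) (max_lt ?_ ?_)
  · rw [Polynomial.natDegree_neg]
    refine lt_of_le_of_lt (Polynomial.natDegree_C_mul_le _ _) ?_
    have h1 := Polynomial.natDegree_mul_le (p := (Polynomial.X : Polynomial ℂ))
      (q := (Polynomial.C (μ : ℂ) + Polynomial.X) ^ n)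
    have := Polynomial.natDegree_X_le (R := ℂ)
    omega
  · have := polyB_natDegree_le μ n p y
    exact lt_of_le_of_lt (Polynomial.natDegree_C_mul_le _ _) (by omega)

/-! ### The Laplace transform over the unit interval -/

/-- The Laplace transform over `[0, 1]` of a complex-valued function. -/
def lap (u : ℝ → ℂ) (s : ℂ) : ℂ := ∫ x in (0 : ℝ)..1, Complex.exp (-s * (x : ℂ)) * u x

/-- The `l`-th derivative of `lap u`, as an integral. -/
def lapDeriv (l : ℕ) (u : ℝ → ℂ) (s : ℂ) : ℂ :=
  ∫ x in (0 : ℝ)..1, (-(x : ℂ)) ^ l * (Complex.exp (-s * (x : ℂ)) * u x)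

theorem lapDeriv_zero (u : ℝ → ℂ) : lapDeriv 0 u = lap u := by
  ext s; simp [lapDeriv, lap]

theorem lap_congr {u v : ℝ → ℂ} (h : ∀ x ∈ Set.Icc (0 : ℝ) 1, u x = v x) : lap u = lap v := by
  ext s
  refine intervalIntegral.integral_congr fun x hx => ?_
  rw [Set.uIcc_of_le zero_le_one] at hx
  simp [h x hx]

theorem lapDeriv_congr {u v : ℝ → ℂ} (h : ∀ x ∈ Set.Icc (0 : ℝ) 1, u x = v x) (l : ℕ) :
    lapDeriv l u = lapDeriv l v := by
  ext s
  refine intervalIntegral.integral_congr fun x hx => ?_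
  rw [Set.uIcc_of_le zero_le_one] at hx
  simp [h x hx]

theorem continuous_lap {u : ℝ → ℂ} (hu : Continuous u) : Continuous (lap u) := by
  refine intervalIntegral.continuous_parametric_intervalIntegral_of_continuous' ?_ 0 1
  simp only [Function.uncurry_def]
  fun_prop

theorem lap_add {u v : ℝ → ℂ} (hu : Continuous u) (hv : Continuous v) (s : ℂ) :
    lap (fun x => u x + v x) s = lap u s + lap v s := by
  simp only [lap, mul_add]
  refine intervalIntegral.integral_add ?_ ?_ <;>
    exact Continuous.intervalIntegrable (by fun_prop) _ _

theorem lap_sub {u v : ℝ → ℂ} (hu : Continuous u) (hv : Continuous v) (s : ℂ) :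
    lap (fun x => u x - v x) s = lap u s - lap v s := by
  simp only [lap, mul_sub]
  refine intervalIntegral.integral_sub ?_ ?_ <;>
    exact Continuous.intervalIntegrable (by fun_prop) _ _

theorem lap_const_mul (c : ℂ) (u : ℝ → ℂ) (s : ℂ) :
    lap (fun x => c * u x) s = c * lap u s := by
  simp only [lap, mul_left_comm _ c]
  exact intervalIntegral.integral_const_mul _ _

theorem lap_sum {ι : Type*} (t : Finset ι) {u : ι → ℝ → ℂ} (hu : ∀ i ∈ t, Continuous (u i))
    (s : ℂ) : lap (fun x => ∑ i ∈ t, u i x) s = ∑ i ∈ t, lap (u i) s := by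
  simp only [lap, Finset.mul_sum]
  refine intervalIntegral.integral_finsetSum fun i hi => ?_
  have := hu i hi
  exact Continuous.intervalIntegrable (by fun_prop) _ _

theorem lap_comp_one_sub (u : ℝ → ℂ) (s : ℂ) :
    lap (fun t => u (1 - t)) s = Complex.exp (-s) * lap u (-s) := by
  have h := intervalIntegral.integral_comp_sub_left (a := 0) (b := 1)
    (fun x : ℝ => Complex.exp (-s) * (Complex.exp (-(-s) * (x : ℂ)) * u x)) 1
  simp only [sub_self, sub_zero, intervalIntegral.integral_const_mul] at h
  rw [lap, lap, ← h]
  rw [← intervalIntegral.integral_const_mul]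
  refine intervalIntegral.integral_congr fun x _ => ?_
  rw [← mul_assoc, ← Complex.exp_add]
  congr 2
  push_cast; ring

/-- Kept in multiplied form so that it also covers `s = r`. -/
theorem lap_exp (r s : ℂ) :
    (s - r) * lap (fun x => Complex.exp (r * (x : ℂ))) s = 1 - Complex.exp (r - s) := by
  by_cases h : s = r
  · simp [h]
  have h1 : r - s ≠ 0 := sub_ne_zero.2 (Ne.symm h)
  have : lap (fun x => Complex.exp (r * (x : ℂ))) s
      = ∫ x in (0 : ℝ)..1, Complex.exp ((r - s) * (x : ℂ)) := by
    refine intervalIntegral.integral_congr fun x _ => ?_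
    simp only []
    rw [← Complex.exp_add]; congr 1; ring
  rw [this, integral_exp_mul_complex h1]
  field_simp
  simp
  ring

theorem hasDerivAt_lapDeriv {u : ℝ → ℂ} (hu : Continuous u) (l : ℕ) (s : ℂ) :
    HasDerivAt (lapDeriv l u) (lapDeriv (l + 1) u s) s := by
  let F' : ℂ → ℝ → ℂ := fun s x => (-(x : ℂ)) ^ (l + 1) * (Complex.exp (-s * (x : ℂ)) * u x)
  have hc : Continuous (fun q : ℂ × ℝ => F' q.1 q.2) := by fun_prop
  obtain ⟨C, hC⟩ := ((isCompact_closedBall s 1).prod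
    (isCompact_Icc (a := (0 : ℝ)) (b := 1))).exists_bound_of_continuousOn hc.continuousOn
  refine (intervalIntegral.hasDerivAt_integral_of_dominated_loc_of_deriv_le (F' := F')
    (bound := fun _ => C) (Metric.closedBall_mem_nhds s one_pos) ?_ ?_ ?_ ?_ ?_ ?_).2
  · refine Filter.Eventually.of_forall fun z => Continuous.aestronglyMeasurable ?_
    fun_prop
  · exact Continuous.intervalIntegrable (by fun_prop) _ _
  · refine Continuous.aestronglyMeasurable ?_
    fun_prop
  · refine Filter.Eventually.of_forall fun t ht z hz => ?_
    rw [Set.uIoc_of_le zero_le_one] at ht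
    exact hC (z, t) ⟨hz, ht.1.le, ht.2⟩
  · exact continuous_const.intervalIntegrable _ _
  · refine Filter.Eventually.of_forall fun t _ z _ => ?_
    have h1 : HasDerivAt (fun z : ℂ => -z * (t : ℂ)) (-(t : ℂ)) z := by
      simpa using (hasDerivAt_id z).neg.mul_const (t : ℂ)
    have h2 := ((h1.cexp.mul_const (u t)).const_mul ((-(t : ℂ)) ^ l))
    refine h2.congr_deriv (Eq.symm ?_)
    change (-(t : ℂ)) ^ (l + 1) * (Complex.exp (-z * (t : ℂ)) * u t) = _
    ring

theorem iteratedDeriv_lap {u : ℝ → ℂ} (hu : Continuous u) (l : ℕ) :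
    iteratedDeriv l (lap u) = lapDeriv l u := by
  induction l with
  | zero => rw [iteratedDeriv_zero, lapDeriv_zero]
  | succ l ih =>
    rw [iteratedDeriv_succ, ih]
    ext s
    exact (hasDerivAt_lapDeriv hu l s).deriv

/-- At `s = 2πik` the transform is the `k`-th Fourier coefficient of `u`. Parseval gives `∫ ‖u‖² =
0`, and continuity gives vanishing at every point, endpoints included. -/
theorem eq_zero_of_lap_eq_zero {u : ℝ → ℂ} (hu : Continuous u) (h : ∀ s, lap u s = 0) :
    ∀ x ∈ Set.Icc (0 : ℝ) 1, u x = 0 := by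
  have hL2 : MemLp u 2 (volume.restrict (Set.Ioc (0 : ℝ) 1)) := by
    obtain ⟨C, hC⟩ := (isCompact_Icc (a := (0 : ℝ)) (b := 1)).exists_bound_of_continuousOn
      hu.continuousOn
    refine MemLp.of_bound hu.aestronglyMeasurable C ?_
    refine (ae_restrict_iff' measurableSet_Ioc).2 (Filter.Eventually.of_forall fun x hx => ?_)
    exact hC x ⟨hx.1.le, hx.2⟩
  have h1 := hasSum_sq_fourierCoeffOn zero_lt_one hL2
  have h2 : ∀ i : ℤ, fourierCoeffOn zero_lt_one u i = 0 := by
    intro i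
    rw [fourierCoeffOn_eq_integral]
    have : ∫ x in (0 : ℝ)..1, (fourier (-i) (x : AddCircle ((1 : ℝ) - 0)) : ℂ) • u x
        = lap u (2 * Real.pi * Complex.I * i) := by
      refine intervalIntegral.integral_congr fun x _ => ?_
      simp only [fourier_coe_apply, smul_eq_mul]
      congr 2
      push_cast; simp
    rw [this, h, smul_zero]
  simp only [h2, norm_zero, sub_zero, inv_one, one_smul, ne_eq, OfNat.ofNat_ne_zero,
    not_false_eq_true, zero_pow] at h1
  have h3 := h1.unique hasSum_zero
  intro x hx
  by_contra hne
  have : 0 < ∫ x in (0 : ℝ)..1, ‖u x‖ ^ 2 := by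
    refine intervalIntegral.integral_pos zero_lt_one (by fun_prop) (fun _ _ => by positivity)
      ⟨x, hx, ?_⟩
    have := norm_pos_iff.2 hne
    positivity
  linarith

/-- Continuous functions on the plane that agree off the zeros of a nonzero polynomial agree. -/
theorem eq_of_eq_off_zeros {F G : ℂ → ℂ} (hF : Continuous F) (hG : Continuous G)
    {q : Polynomial ℂ} (hq : q ≠ 0) (h : ∀ s, q.eval s ≠ 0 → F s = G s) : F = G := by
  have hfin : {s : ℂ | q.eval s = 0}.Finite := by
    refine (q.roots.toFinset.finite_toSet).subset fun s hs => ?_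
    simpa [hq] using hs
  have hd : Dense ({s : ℂ | q.eval s = 0}ᶜ) := by
    have := (dense_univ (X := ℂ)).sdiff_finite hfin
    rwa [← Set.compl_eq_univ_sdiff] at this
  exact Continuous.ext_on hd hF hG fun s hs => h s hs

/-! ### Exponential sums and their transform -/

/-- The combination of the exponentials `e^{r_i x}` that belongs to `(p, y)`. -/
def expSum (μ : ℝ) (n : ℕ) (p : ℂ) (y : ℕ → ℂ) (r : Fin (2 * n + 2) → ℂ) (x : ℝ) : ℂ :=
  ∑ i, coeffC μ n p y (r i) * Complex.exp (r i * (x : ℂ))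

theorem continuous_expSum (μ : ℝ) (n : ℕ) (p : ℂ) (y : ℕ → ℂ) (r : Fin (2 * n + 2) → ℂ) :
    Continuous (expSum μ n p y r) := by
  unfold expSum; fun_prop

theorem lap_expSum (μ : ℝ) (n : ℕ) (p : ℂ) (y : ℕ → ℂ) (r : Fin (2 * n + 2) → ℂ) (s : ℂ) :
    lap (expSum μ n p y r) s
      = ∑ i, coeffC μ n p y (r i) * lap (fun x => Complex.exp (r i * (x : ℂ))) s := by
  have := lap_sum Finset.univ (u := fun i x => coeffC μ n p y (r i) * Complex.exp (r i * (x : ℂ)))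
    (fun i _ => by fun_prop) s
  simp only [lap_const_mul] at this
  exact this

/-- The hypothesis says `Q(r_i) = -e^{r_i} P(r_i)`. The partial fractions of `P` and of `e^{-s} Q`
therefore merge into `c_i (1 - e^{r_i - s}) / (s - r_i)`, the transform of `c_i e^{r_i x}`. At a
zero of `R` both sides are zero. -/
theorem lap_expSum_eq {μ : ℝ} {n : ℕ} (p : ℂ) (y : ℕ → ℂ)
    {r : Fin (2 * n + 2) → ℂ} (hr : IsZeroEnumeration μ n r)
    (h : ∀ i, (polyP μ n p y).eval (r i) + Complex.exp (-r i) * (polyQ μ n p y).eval (r i) = 0)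
    (s : ℂ) :
    (polyR μ n).eval s * lap (expSum μ n p y r) s
      = (polyP μ n p y).eval s + Complex.exp (-s) * (polyQ μ n p y).eval s := by
  by_cases hs : (polyR μ n).eval s = 0
  · obtain ⟨i, rfl⟩ : s ∈ Set.range r := by rw [hr.range_eq]; exact hs
    rw [hs, h, zero_mul]
  have hdeg : ∀ q : Polynomial ℂ, q.natDegree < 2 * n + 2 →
      q.degree < ((2 * n + 2 : ℕ) : WithBot ℕ) := fun q hq =>
    lt_of_le_of_lt Polynomial.degree_le_natDegree (by exact_mod_cast hq)
  rw [hr.eval_eq_sum _ (hdeg _ (polyP_natDegree_lt μ n p y)) s hs,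
    hr.eval_eq_sum _ (hdeg _ (polyQ_natDegree_lt μ n p y)) s hs, mul_left_comm, ← mul_add,
    Finset.mul_sum, ← Finset.sum_add_distrib, lap_expSum]
  congr 1
  refine Finset.sum_congr rfl fun i _ => ?_
  have hsr : s - r i ≠ 0 := by
    rw [sub_ne_zero]; rintro rfl; exact hs (hr.eval_eq_zero i)
  have h1 := lap_exp (r i) s
  have h2 : lap (fun x => Complex.exp (r i * (x : ℂ))) s
      = (1 - Complex.exp (r i) * Complex.exp (-s)) / (s - r i) := by
    rw [eq_div_iff hsr, mul_comm, h1, sub_eq_add_neg (r i), Complex.exp_add]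
  have h3 : (polyQ μ n p y).eval (r i) = - (Complex.exp (r i) * (polyP μ n p y).eval (r i)) := by
    have h4 : Complex.exp (r i) * Complex.exp (-r i) = 1 := by rw [← Complex.exp_add]; simp
    linear_combination Complex.exp (r i) * h i - (polyQ μ n p y).eval (r i) * h4
  rw [h2, h3, coeffC]
  ring

/-! ### The Erlang distribution function and the transform of its convolution -/

/-- Differentiation telescopes the partial exponential sum down to its last term. Used with `a = μ +
s` for the Laplace transform and with `a = μ` for the Erlang density. -/
theorem hasDerivAt_exp_mul_partialSum (a : ℂ) (j : ℕ) (T : ℂ) :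
    HasDerivAt (fun T : ℂ => Complex.exp (-(a * T)) *
        ∑ i ∈ Finset.range (j + 1), (a * T) ^ i / (Nat.factorial i : ℂ))
      (-(a * (Complex.exp (-(a * T)) * ((a * T) ^ j / (Nat.factorial j : ℂ))))) T := by
  have h0 : HasDerivAt (fun T : ℂ => a * T) a T := by
    simpa using (hasDerivAt_id T).const_mul a
  have hE := h0.neg.cexp
  induction j with
  | zero => simpa [mul_comm] using hE
  | succ j ih =>
    have h1 := ih.add (hE.mul ((h0.pow (j + 1)).div_const (Nat.factorial (j + 1) : ℂ)))
    refine (h1.congr_deriv ?_).congr_of_eventuallyEq (Filter.Eventually.of_forall fun T => ?_)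
    · have h2 : ((Nat.factorial (j + 1) : ℕ) : ℂ) = (j + 1) * (Nat.factorial j : ℂ) := by
        rw [Nat.factorial_succ]; push_cast; ring
      have h3 : (Nat.factorial j : ℂ) ≠ 0 := by exact_mod_cast Nat.factorial_ne_zero j
      have h4 : (j : ℂ) + 1 ≠ 0 := by exact_mod_cast Nat.succ_ne_zero j
      simp only [h2, Pi.neg_apply, Pi.pow_apply]
      push_cast
      field_simp
      ring_nf
    · simp only [Pi.add_apply, Pi.mul_apply, Pi.neg_apply, Pi.pow_apply]
      rw [Finset.sum_range_succ _ (j + 1), mul_add]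

theorem ofReal_erlangCDF (μ : ℝ) (n : ℕ) (x : ℝ) :
    (erlangCDF μ n x : ℂ) = 1 - Complex.exp (-((μ : ℂ) * x)) *
      ∑ j ∈ Finset.range n, ((μ : ℂ) * x) ^ j / (Nat.factorial j : ℂ) := by
  simp [erlangCDF]

theorem erlangCDF_zero (μ : ℝ) {n : ℕ} (hn : 1 ≤ n) : erlangCDF μ n 0 = 0 := by
  obtain ⟨m, rfl⟩ : ∃ m, n = m + 1 := ⟨n - 1, by omega⟩
  simp [erlangCDF, Finset.sum_range_succ']

/-- The distribution function of the Erlang distribution on the whole line. -/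
def erlangExt (μ : ℝ) (n : ℕ) (x : ℝ) : ℝ := erlangCDF μ n (max x 0)

theorem continuous_erlangCDF (μ : ℝ) (n : ℕ) : Continuous (erlangCDF μ n) := by
  unfold erlangCDF; fun_prop

@[fun_prop]
theorem continuous_erlangExt (μ : ℝ) (n : ℕ) : Continuous (erlangExt μ n) :=
  (continuous_erlangCDF μ n).comp (by fun_prop)

theorem erlangExt_of_nonneg (μ : ℝ) (n : ℕ) {x : ℝ} (hx : 0 ≤ x) :
    erlangExt μ n x = erlangCDF μ n x := by
  rw [erlangExt, max_eq_left hx]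

theorem erlangExt_of_nonpos (μ : ℝ) {n : ℕ} (hn : 1 ≤ n) {x : ℝ} (hx : x ≤ 0) :
    erlangExt μ n x = 0 := by
  rw [erlangExt, max_eq_right hx, erlangCDF_zero μ hn]

/-- `s (μ + s)ⁿ` times the Laplace transform of the Erlang distribution function over `[0, T]`. -/
def erlangLap (μ : ℝ) (n : ℕ) (s : ℂ) (T : ℂ) : ℂ :=
  (μ : ℂ) ^ n - Complex.exp (-(s * T)) * ((μ : ℂ) + s) ^ n +
    s * ∑ j ∈ Finset.range n, (μ : ℂ) ^ j * ((μ : ℂ) + s) ^ (n - 1 - j) *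
      (Complex.exp (-(((μ : ℂ) + s) * T)) *
        ∑ i ∈ Finset.range (j + 1), (((μ : ℂ) + s) * T) ^ i / (Nat.factorial i : ℂ))

theorem erlangLap_zero (μ : ℝ) (n : ℕ) (s : ℂ) : erlangLap μ n s 0 = 0 := by
  -- The boundary value at `T = 0` is the factorization of `μⁿ - (μ + s)ⁿ` as a geometric sum times
  -- `-s`.
  have h := (Commute.all (μ : ℂ) ((μ : ℂ) + s)).geom_sum₂_mul n
  have h1 : ∀ j, ∑ i ∈ Finset.range (j + 1),
      (((μ : ℂ) + s) * 0) ^ i / (Nat.factorial i : ℂ) = 1 := by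
    intro j; simp [Finset.sum_range_succ']
  simp only [erlangLap, h1]
  simp only [mul_zero, neg_zero, Complex.exp_zero, one_mul, mul_one]
  linear_combination -h

theorem hasDerivAt_erlangLap (μ : ℝ) (n : ℕ) (s : ℂ) (T : ℝ) :
    HasDerivAt (fun T : ℝ => erlangLap μ n s (T : ℂ))
      (s * ((μ : ℂ) + s) ^ n * (Complex.exp (-s * (T : ℂ)) * (erlangCDF μ n T : ℂ))) T := by
  have h0 : HasDerivAt (fun T : ℂ => Complex.exp (-(s * T))) (Complex.exp (-(s * T)) * (-s)) T := by
    simpa using ((hasDerivAt_id (T : ℂ)).const_mul s).neg.cexp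
  have h1 := fun j (_ : j ∈ Finset.range n) => (hasDerivAt_exp_mul_partialSum ((μ : ℂ) + s) j
    (T : ℂ)).const_mul ((μ : ℂ) ^ j * ((μ : ℂ) + s) ^ (n - 1 - j))
  have h2 := ((h0.mul_const (((μ : ℂ) + s) ^ n)).const_sub ((μ : ℂ) ^ n)).add
    ((HasDerivAt.fun_sum h1).const_mul s)
  refine (h2.congr_deriv ?_).comp_ofReal
  have h3 : ∀ j ∈ Finset.range n, (μ : ℂ) ^ j * ((μ : ℂ) + s) ^ (n - 1 - j) *
      (-(((μ : ℂ) + s) * (Complex.exp (-(((μ : ℂ) + s) * T)) *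
        ((((μ : ℂ) + s) * T) ^ j / (Nat.factorial j : ℂ)))))
      = -(((μ : ℂ) + s) ^ n * Complex.exp (-s * T) * Complex.exp (-((μ : ℂ) * T)) *
        (((μ : ℂ) * T) ^ j / (Nat.factorial j : ℂ))) := by
    intro j hj
    rw [Finset.mem_range] at hj
    have h4 : ((μ : ℂ) + s) ^ n = ((μ : ℂ) + s) ^ (n - 1 - j) * ((μ : ℂ) + s) * ((μ : ℂ) + s) ^ j := by
      rw [← pow_succ, ← pow_add]; congr 1; omega
    have h5 : Complex.exp (-(((μ : ℂ) + s) * T))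
        = Complex.exp (-s * T) * Complex.exp (-((μ : ℂ) * T)) := by
      rw [← Complex.exp_add]; congr 1; ring
    rw [h4, h5, mul_pow, mul_pow]
    ring
  rw [Finset.sum_congr rfl h3, ofReal_erlangCDF, Finset.sum_neg_distrib, ← Finset.mul_sum]
  simp only [neg_mul]
  ring

theorem integral_exp_mul_erlangCDF (μ : ℝ) (n : ℕ) (s : ℂ) (T : ℝ) :
    s * ((μ : ℂ) + s) ^ n * ∫ t in (0 : ℝ)..T, Complex.exp (-s * (t : ℂ)) * (erlangCDF μ n t : ℂ)
      = erlangLap μ n s T := by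
  have hc := continuous_erlangCDF μ n
  rw [← intervalIntegral.integral_const_mul,
    intervalIntegral.integral_eq_sub_of_hasDerivAt (fun t _ => hasDerivAt_erlangLap μ n s t)
    (Continuous.intervalIntegrable (by fun_prop) _ _)]
  simp [erlangLap_zero]

theorem lap_erlangExt_sub (μ : ℝ) {n : ℕ} (hn : 1 ≤ n) (s : ℂ) {y : ℝ}
    (hy : y ∈ Set.Icc (0 : ℝ) 1) :
    s * ((μ : ℂ) + s) ^ n * lap (fun t => (erlangExt μ n (t - y) : ℂ)) s
      = Complex.exp (-s * (y : ℂ)) * erlangLap μ n s (1 - y) := by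
  have hint : ∀ a b : ℝ, IntervalIntegrable (fun t : ℝ => Complex.exp (-s * (t : ℂ)) *
      (erlangExt μ n (t - y) : ℂ)) volume a b := fun a b =>
    Continuous.intervalIntegrable (by fun_prop) _ _
  have h1 : ∫ t in (0 : ℝ)..y, Complex.exp (-s * (t : ℂ)) * (erlangExt μ n (t - y) : ℂ) = 0 := by
    rw [← intervalIntegral.integral_zero (E := ℂ) (a := 0) (b := y) (μ := volume)]
    refine intervalIntegral.integral_congr fun t ht => ?_
    rw [Set.uIcc_of_le hy.1] at ht
    simp [erlangExt_of_nonpos μ hn (sub_nonpos.2 ht.2)]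
  have h2 : ∫ t in y..1, Complex.exp (-s * (t : ℂ)) * (erlangExt μ n (t - y) : ℂ)
      = Complex.exp (-s * (y : ℂ)) *
        ∫ t in (0 : ℝ)..(1 - y), Complex.exp (-s * (t : ℂ)) * (erlangCDF μ n t : ℂ) := by
    have h3 := intervalIntegral.integral_comp_sub_right (a := y) (b := 1)
      (fun t : ℝ => Complex.exp (-s * (y : ℂ)) *
        (Complex.exp (-s * (t : ℂ)) * (erlangExt μ n t : ℂ))) y
    rw [sub_self] at h3
    have h4 : ∫ t in (0 : ℝ)..(1 - y), Complex.exp (-s * (t : ℂ)) * (erlangExt μ n t : ℂ)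
        = ∫ t in (0 : ℝ)..(1 - y), Complex.exp (-s * (t : ℂ)) * (erlangCDF μ n t : ℂ) := by
      refine intervalIntegral.integral_congr fun t ht => ?_
      rw [Set.uIcc_of_le (by linarith [hy.2])] at ht
      simp [erlangExt_of_nonneg μ n ht.1]
    rw [← h4, ← intervalIntegral.integral_const_mul, ← h3]
    refine intervalIntegral.integral_congr fun t _ => ?_
    rw [← mul_assoc, ← Complex.exp_add]
    congr 2
    push_cast; ring
  rw [lap, ← intervalIntegral.integral_add_adjacent_intervals (hint 0 y) (hint y 1), h1, h2,
    zero_add, mul_left_comm, integral_exp_mul_erlangCDF]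
  push_cast; rfl

/-- The right-hand side of the integral equation for the density: the convolution of the Erlang
distribution function with the atom `p` at `0` and the density `u` on `[0, 1]`. -/
def erlangConv (μ : ℝ) (n : ℕ) (p : ℂ) (u : ℝ → ℂ) (t : ℝ) : ℂ :=
  p * (erlangExt μ n t : ℂ) + ∫ y in (0 : ℝ)..1, (erlangExt μ n (t - y) : ℂ) * u y

theorem continuous_erlangConv (μ : ℝ) (n : ℕ) (p : ℂ) {u : ℝ → ℂ} (hu : Continuous u) :
    Continuous (erlangConv μ n p u) := by
  unfold erlangConv
  have : Continuous fun t : ℝ => ∫ y in (0 : ℝ)..1, (erlangExt μ n (t - y) : ℂ) * u y := by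
    refine intervalIntegral.continuous_parametric_intervalIntegral_of_continuous' ?_ 0 1
    simp only [Function.uncurry_def]
    fun_prop
  fun_prop

theorem lap_erlangConv (μ : ℝ) {n : ℕ} (hn : 1 ≤ n) (p : ℂ) {u : ℝ → ℂ} (hu : Continuous u)
    (s : ℂ) :
    s * ((μ : ℂ) + s) ^ n * lap (erlangConv μ n p u) s
      = p * erlangLap μ n s 1 +
        ∫ y in (0 : ℝ)..1, Complex.exp (-s * (y : ℂ)) * erlangLap μ n s (1 - y) * u y := by
  have hcont : Continuous fun t : ℝ => ∫ y in (0 : ℝ)..1, (erlangExt μ n (t - y) : ℂ) * u y := by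
    refine intervalIntegral.continuous_parametric_intervalIntegral_of_continuous' ?_ 0 1
    simp only [Function.uncurry_def]
    fun_prop
  have h1 : lap (erlangConv μ n p u) s = p * lap (fun t => (erlangExt μ n t : ℂ)) s +
      lap (fun t => ∫ y in (0 : ℝ)..1, (erlangExt μ n (t - y) : ℂ) * u y) s := by
    rw [← lap_const_mul, ← lap_add (by fun_prop) hcont]
    rfl
  have h2 : lap (fun t => ∫ y in (0 : ℝ)..1, (erlangExt μ n (t - y) : ℂ) * u y) s
      = ∫ y in (0 : ℝ)..1, lap (fun t => (erlangExt μ n (t - y) : ℂ)) s * u y := by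
    simp only [lap, ← intervalIntegral.integral_const_mul, ← intervalIntegral.integral_mul_const]
    rw [intervalIntegral_intervalIntegral_swap]
    · simp only [mul_assoc]
    · rw [Set.uIoc_of_le zero_le_one]
      have hc : Continuous (Function.uncurry fun (t y : ℝ) => Complex.exp (-s * (t : ℂ)) *
          ((erlangExt μ n (t - y) : ℂ) * u y)) := by
        simp only [Function.uncurry_def]; fun_prop
      exact (hc.continuousOn.integrableOn_compact (isCompact_Icc.prod isCompact_Icc)).mono_set
        (Set.prod_mono Set.Ioc_subset_Icc_self Set.Ioc_subset_Icc_self)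
  have h0 := lap_erlangExt_sub μ hn s (y := 0) ⟨le_rfl, zero_le_one⟩
  simp only [sub_zero, Complex.ofReal_zero, mul_zero, Complex.exp_zero, one_mul] at h0
  rw [h1, h2, mul_add, mul_left_comm, h0, ← intervalIntegral.integral_const_mul]
  congr 1
  refine intervalIntegral.integral_congr fun y hy => ?_
  rw [Set.uIcc_of_le zero_le_one] at hy
  rw [← mul_assoc, lap_erlangExt_sub μ hn s hy]

theorem polyB_eval (μ : ℝ) (n : ℕ) (p : ℂ) (y : ℕ → ℂ) (s : ℂ) :
    (polyB μ n p y).eval s = Complex.exp (-(μ : ℂ)) *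
      (∑ j ∈ Finset.range n, ∑ i ∈ Finset.range (j + 1),
        ((μ : ℂ) ^ j / (Nat.factorial i : ℂ) * (s * ((μ : ℂ) + s) ^ (n - 1 - j + i))) *
          (p + ∑ l ∈ Finset.range (i + 1), (Nat.choose i l : ℂ) * y l)) - ((μ : ℂ) + s) ^ n := by
  simp only [polyB, Polynomial.eval_sub, Polynomial.eval_mul, Polynomial.eval_C,
    Polynomial.eval_finsetSum, Polynomial.eval_pow, Polynomial.eval_add, Polynomial.eval_X]
  congr 2
  refine Finset.sum_congr rfl fun j _ => Finset.sum_congr rfl fun i _ => ?_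
  ring

/-- Separates the variables: each summand becomes a function of `s` times a function of `y`, so that
integrating against `u y` leaves only the moments of `(1 - y)^i e^{μ y}`. -/
theorem exp_mul_erlangLap (μ : ℝ) (n : ℕ) (s y : ℂ) :
    Complex.exp (-s * y) * erlangLap μ n s (1 - y)
      = (μ : ℂ) ^ n * Complex.exp (-s * y) - Complex.exp (-s) * ((μ : ℂ) + s) ^ n +
        Complex.exp (-s) * Complex.exp (-(μ : ℂ)) *
          ∑ j ∈ Finset.range n, ∑ i ∈ Finset.range (j + 1),
            ((μ : ℂ) ^ j / (Nat.factorial i : ℂ) * (s * ((μ : ℂ) + s) ^ (n - 1 - j + i))) *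
              ((1 - y) ^ i * Complex.exp ((μ : ℂ) * y)) := by
  have h1 : Complex.exp (-s * y) * Complex.exp (-(s * (1 - y))) = Complex.exp (-s) := by
    rw [← Complex.exp_add]; congr 1; ring
  have h2 : Complex.exp (-s * y) * Complex.exp (-(((μ : ℂ) + s) * (1 - y)))
      = Complex.exp (-s) * Complex.exp (-(μ : ℂ)) * Complex.exp ((μ : ℂ) * y) := by
    rw [← Complex.exp_add, ← Complex.exp_add, ← Complex.exp_add]; congr 1; ring
  have h3 : Complex.exp (-s * y) * (s * ∑ j ∈ Finset.range n,
      (μ : ℂ) ^ j * ((μ : ℂ) + s) ^ (n - 1 - j) *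
      (Complex.exp (-(((μ : ℂ) + s) * (1 - y))) *
        ∑ i ∈ Finset.range (j + 1), (((μ : ℂ) + s) * (1 - y)) ^ i / (Nat.factorial i : ℂ)))
      = Complex.exp (-s) * Complex.exp (-(μ : ℂ)) *
          ∑ j ∈ Finset.range n, ∑ i ∈ Finset.range (j + 1),
            ((μ : ℂ) ^ j / (Nat.factorial i : ℂ) * (s * ((μ : ℂ) + s) ^ (n - 1 - j + i))) *
              ((1 - y) ^ i * Complex.exp ((μ : ℂ) * y)) := by
    simp only [Finset.mul_sum]
    refine Finset.sum_congr rfl fun j _ => Finset.sum_congr rfl fun i _ => ?_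
    rw [mul_pow, pow_add]
    linear_combination (s * (μ : ℂ) ^ j * ((μ : ℂ) + s) ^ (n - 1 - j) *
      (((μ : ℂ) + s) ^ i * (1 - y) ^ i / (Nat.factorial i : ℂ))) * h2
  rw [erlangLap, mul_add, h3]
  linear_combination (-((μ : ℂ) + s) ^ n) * h1

/-- The binomial expansion of `(1 + (-y))^i` matches the factors `(-y)^l` that differentiation of
the transform produces. This is the origin of the derivatives of `φ` at `-μ`. -/
theorem integral_one_sub_pow_mul_exp (μ : ℝ) {u : ℝ → ℂ} (hu : Continuous u) (i : ℕ) :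
    ∫ y in (0 : ℝ)..1, (1 - (y : ℂ)) ^ i * Complex.exp ((μ : ℂ) * y) * u y
      = ∑ l ∈ Finset.range (i + 1), (Nat.choose i l : ℂ) * lapDeriv l u (-(μ : ℂ)) := by
  simp only [lapDeriv, ← intervalIntegral.integral_const_mul]
  rw [← intervalIntegral.integral_finsetSum
    (fun l _ => Continuous.intervalIntegrable (by fun_prop) _ _)]
  refine intervalIntegral.integral_congr fun y _ => ?_
  have h : (1 - (y : ℂ)) ^ i = ∑ l ∈ Finset.range (i + 1), (-(y : ℂ)) ^ l * (Nat.choose i l : ℂ) := by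
    rw [sub_eq_neg_add, add_pow]; simp
  simp only [h, neg_neg, Finset.sum_mul]
  exact Finset.sum_congr rfl fun l _ => by ring

/-- The Laplace transform of `erlangConv`. -/
theorem lap_erlangConv_eq (μ : ℝ) {n : ℕ} (hn : 1 ≤ n) (p : ℂ) {u : ℝ → ℂ} (hu : Continuous u)
    (s : ℂ) :
    s * ((μ : ℂ) + s) ^ n * lap (erlangConv μ n p u) s
      = (μ : ℂ) ^ n * (p + lap u s) + Complex.exp (-s) *
        ((polyB μ n p (fun l => lapDeriv l u (-(μ : ℂ)))).eval s +
          (1 - p - lap u 0) * ((μ : ℂ) + s) ^ n) := by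
  -- The factor of `-e^{-s} (μ + s)ⁿ` that arises is the mass `p + lap u 0`, whereas `polyB` has
  -- mass one built in. The correction term keeps the identity valid for every continuous `u`, as
  -- uniqueness needs.
  rw [lap_erlangConv μ hn p hu]
  have h1 := exp_mul_erlangLap μ n s 0
  simp only [mul_zero, Complex.exp_zero, sub_zero, one_mul, mul_one, one_pow] at h1
  have h2 : ∫ y in (0 : ℝ)..1, Complex.exp (-s * (y : ℂ)) * erlangLap μ n s (1 - y) * u y
      = (μ : ℂ) ^ n * lap u s - Complex.exp (-s) * ((μ : ℂ) + s) ^ n * lap u 0 +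
        Complex.exp (-s) * Complex.exp (-(μ : ℂ)) *
          ∑ j ∈ Finset.range n, ∑ i ∈ Finset.range (j + 1),
            ((μ : ℂ) ^ j / (Nat.factorial i : ℂ) * (s * ((μ : ℂ) + s) ^ (n - 1 - j + i))) *
              ∑ l ∈ Finset.range (i + 1), (Nat.choose i l : ℂ) * lapDeriv l u (-(μ : ℂ)) := by
    simp only [exp_mul_erlangLap, ← integral_one_sub_pow_mul_exp μ hu, lap,
      ← intervalIntegral.integral_const_mul]
    rw [← intervalIntegral.integral_sub
      (Continuous.intervalIntegrable (by fun_prop) _ _)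
      (Continuous.intervalIntegrable (by fun_prop) _ _)]
    have h3 : ∑ j ∈ Finset.range n, ∑ i ∈ Finset.range (j + 1), ∫ y in (0 : ℝ)..1,
        ((μ : ℂ) ^ j / (Nat.factorial i : ℂ) * (s * ((μ : ℂ) + s) ^ (n - 1 - j + i))) *
          ((1 - (y : ℂ)) ^ i * Complex.exp ((μ : ℂ) * y) * u y)
        = ∫ y in (0 : ℝ)..1, ∑ j ∈ Finset.range n, ∑ i ∈ Finset.range (j + 1),
        ((μ : ℂ) ^ j / (Nat.factorial i : ℂ) * (s * ((μ : ℂ) + s) ^ (n - 1 - j + i))) *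
          ((1 - (y : ℂ)) ^ i * Complex.exp ((μ : ℂ) * y) * u y) := by
      rw [intervalIntegral.integral_finsetSum
        (fun j _ => Continuous.intervalIntegrable (by fun_prop) _ _)]
      refine Finset.sum_congr rfl fun j _ => ?_
      rw [intervalIntegral.integral_finsetSum
        (fun i _ => Continuous.intervalIntegrable (by fun_prop) _ _)]
    rw [h3, ← intervalIntegral.integral_const_mul, ← intervalIntegral.integral_add
      (Continuous.intervalIntegrable (by fun_prop) _ _)
      (Continuous.intervalIntegrable (by fun_prop) _ _)]
    refine intervalIntegral.integral_congr fun y _ => ?_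
    simp only [neg_zero, zero_mul, Complex.exp_zero, one_mul]
    have h4 : (∑ j ∈ Finset.range n, ∑ i ∈ Finset.range (j + 1),
        ((μ : ℂ) ^ j / (Nat.factorial i : ℂ) * (s * ((μ : ℂ) + s) ^ (n - 1 - j + i))) *
          ((1 - (y : ℂ)) ^ i * Complex.exp ((μ : ℂ) * y) * u y))
        = (∑ j ∈ Finset.range n, ∑ i ∈ Finset.range (j + 1),
        ((μ : ℂ) ^ j / (Nat.factorial i : ℂ) * (s * ((μ : ℂ) + s) ^ (n - 1 - j + i))) *
          ((1 - (y : ℂ)) ^ i * Complex.exp ((μ : ℂ) * y))) * u y := by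
      simp only [Finset.sum_mul, mul_assoc]
    rw [h4]
    ring
  rw [h1, h2, polyB_eval]
  simp only [mul_add, Finset.sum_add_distrib, ← Finset.sum_mul]
  ring

/-! ### Uniqueness for the integral equation -/

theorem erlangCDF_le (μ : ℝ) (hμ : 0 < μ) {n : ℕ} (hn : 1 ≤ n) {t : ℝ}
    (ht : t ∈ Set.Icc (0 : ℝ) 1) : erlangCDF μ n t ≤ 1 - Real.exp (-μ) := by
  have h1 : (1 : ℝ) ≤ ∑ j ∈ Finset.range n, (μ * t) ^ j / (Nat.factorial j : ℝ) := by
    have := Finset.single_le_sum (f := fun j => (μ * t) ^ j / (Nat.factorial j : ℝ))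
      (fun j _ => div_nonneg (pow_nonneg (mul_nonneg hμ.le ht.1) _) (Nat.cast_nonneg _))
      (Finset.mem_range.2 (show 0 < n by omega))
    simpa using this
  have h2 : Real.exp (-μ) ≤ Real.exp (-μ * t) := Real.exp_le_exp.2 (by nlinarith [ht.2])
  have h3 := Real.exp_pos (-μ * t)
  rw [erlangCDF]
  nlinarith

/-- The density of the Erlang distribution. -/
def erlangDensity (μ : ℝ) (n : ℕ) (t : ℝ) : ℝ :=
  μ * (Real.exp (-(μ * t)) * ((μ * t) ^ (n - 1) / (Nat.factorial (n - 1) : ℝ)))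

@[fun_prop]
theorem continuous_erlangDensity (μ : ℝ) (n : ℕ) : Continuous (erlangDensity μ n) := by
  unfold erlangDensity; fun_prop

theorem erlangDensity_nonneg {μ : ℝ} (hμ : 0 < μ) (n : ℕ) {t : ℝ} (ht : 0 ≤ t) :
    0 ≤ erlangDensity μ n t := by
  unfold erlangDensity; positivity

theorem hasDerivAt_erlangCDF (μ : ℝ) {n : ℕ} (hn : 1 ≤ n) (t : ℝ) :
    HasDerivAt (erlangCDF μ n) (erlangDensity μ n t) t := by
  obtain ⟨m, rfl⟩ : ∃ m, n = m + 1 := ⟨n - 1, by omega⟩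
  have h := ((hasDerivAt_exp_mul_partialSum (μ : ℂ) m (t : ℂ)).const_sub 1).real_of_complex
  refine (h.congr_deriv ?_).congr_of_eventuallyEq (Filter.Eventually.of_forall fun x => ?_)
  · rw [neg_neg]
    have : (μ : ℂ) * (Complex.exp (-((μ : ℂ) * t)) * (((μ : ℂ) * t) ^ m / (Nat.factorial m : ℂ)))
        = ((erlangDensity μ (m + 1) t : ℝ) : ℂ) := by
      simp [erlangDensity]
    rw [this, Complex.ofReal_re]
  · simp only []
    rw [← ofReal_erlangCDF, Complex.ofReal_re]

/-- Integration by parts: `G(0) = 0` removes one boundary term, and the other cancels `p G(t)`. With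
a nonnegative kernel against the cumulative mass, the convolution can be bounded by the supremum of
that mass. -/
theorem erlangConv_eq_integral_density (μ : ℝ) {n : ℕ} (hn : 1 ≤ n) (p : ℂ) {u : ℝ → ℂ}
    (hu : Continuous u) {t : ℝ} (ht : t ∈ Set.Icc (0 : ℝ) 1) :
    erlangConv μ n p u t
      = ∫ y in (0 : ℝ)..t, (erlangDensity μ n (t - y) : ℂ) * (p + ∫ x in (0 : ℝ)..y, u x) := by
  have hF : ∀ y, HasDerivAt (fun y : ℝ => p + ∫ x in (0 : ℝ)..y, u x) (u y) y := fun y =>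
    (intervalIntegral.integral_hasDerivAt_right (hu.intervalIntegrable _ _)
      (hu.stronglyMeasurableAtFilter _ _) hu.continuousAt).const_add p
  have hG : ∀ y, HasDerivAt (fun y : ℝ => (erlangCDF μ n (t - y) : ℂ))
      (-(erlangDensity μ n (t - y) : ℂ)) y := fun y => by
    have h1 := (hasDerivAt_erlangCDF μ hn (t - y)).comp y ((hasDerivAt_id y).const_sub t)
    simpa using h1.ofReal_comp
  have hint : ∀ a b : ℝ, IntervalIntegrable (fun y : ℝ => (erlangExt μ n (t - y) : ℂ) * u y)
      volume a b := fun a b => Continuous.intervalIntegrable (by fun_prop) _ _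
  have h1 : ∫ y in t..1, (erlangExt μ n (t - y) : ℂ) * u y = 0 := by
    rw [← intervalIntegral.integral_zero (E := ℂ) (a := t) (b := 1) (μ := volume)]
    refine intervalIntegral.integral_congr fun y hy => ?_
    rw [Set.uIcc_of_le ht.2] at hy
    simp [erlangExt_of_nonpos μ hn (sub_nonpos.2 hy.1)]
  have h2 : ∫ y in (0 : ℝ)..t, (erlangExt μ n (t - y) : ℂ) * u y
      = ∫ y in (0 : ℝ)..t, (erlangCDF μ n (t - y) : ℂ) * u y := by
    refine intervalIntegral.integral_congr fun y hy => ?_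
    rw [Set.uIcc_of_le ht.1] at hy
    simp [erlangExt_of_nonneg μ n (sub_nonneg.2 hy.2)]
  have h3 := intervalIntegral.integral_mul_deriv_eq_deriv_mul (a := 0) (b := t)
    (fun y _ => hG y) (fun y _ => hF y) (Continuous.intervalIntegrable (by fun_prop) _ _)
    (hu.intervalIntegrable _ _)
  rw [erlangConv, ← intervalIntegral.integral_add_adjacent_intervals (hint 0 t) (hint t 1), h1, h2,
    h3, erlangExt_of_nonneg μ n ht.1]
  simp only [sub_self, sub_zero, erlangCDF_zero μ hn, neg_mul, intervalIntegral.integral_neg,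
    intervalIntegral.integral_same]
  push_cast
  ring

/-- The homogeneous integral equation has only the trivial solution of total mass `0`. -/
theorem eq_zero_of_erlangConv {μ : ℝ} (hμ : 0 < μ) {n : ℕ} (hn : 1 ≤ n) {p : ℂ} {u : ℝ → ℂ}
    (hu : Continuous u) (hmass : p + lap u 0 = 0)
    (h : ∀ t ∈ Set.Icc (0 : ℝ) 1, u (1 - t) = erlangConv μ n p u t) :
    p = 0 ∧ ∀ x ∈ Set.Icc (0 : ℝ) 1, u x = 0 := by
  set F : ℝ → ℂ := fun y => p + ∫ x in (0 : ℝ)..y, u x with hF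
  have hFc : Continuous F :=
    continuous_const.add (intervalIntegral.continuous_primitive (fun _ _ => hu.intervalIntegrable _ _) 0)
  obtain ⟨x₀, hx₀, hmax⟩ := (isCompact_Icc (a := (0 : ℝ)) (b := 1)).exists_isMaxOn
    ⟨0, by simp⟩ hFc.norm.continuousOn
  set M := ‖F x₀‖ with hM
  have hM0 : 0 ≤ M := norm_nonneg _
  have hFM : ∀ x ∈ Set.Icc (0 : ℝ) 1, ‖F x‖ ≤ M := fun x hx => hmax hx
  set c := 1 - Real.exp (-μ) with hc
  have hc1 : c < 1 := by have := Real.exp_pos (-μ); linarith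
  -- The kernel has total mass `G(1 - x) ≤ 1 - e^{-μ}`, so `u` is bounded by `c` times the supremum
  -- `M` of the cumulative mass `F`.
  have hu1 : ∀ x ∈ Set.Icc (0 : ℝ) 1, ‖u x‖ ≤ M * c := by
    intro x hx
    have ht : 1 - x ∈ Set.Icc (0 : ℝ) 1 := ⟨by linarith [hx.2], by linarith [hx.1]⟩
    have h1 := h (1 - x) ht
    rw [sub_sub_cancel, erlangConv_eq_integral_density μ hn p hu ht] at h1
    have h2 : ∫ y in (0 : ℝ)..(1 - x), erlangDensity μ n (1 - x - y) * M
        = erlangCDF μ n (1 - x) * M := by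
      rw [intervalIntegral.integral_mul_const,
        intervalIntegral.integral_comp_sub_left (fun y => erlangDensity μ n y), sub_self, sub_zero,
        intervalIntegral.integral_eq_sub_of_hasDerivAt (fun y _ => hasDerivAt_erlangCDF μ hn y)
          (Continuous.intervalIntegrable (by fun_prop) _ _), erlangCDF_zero μ hn, sub_zero]
    calc ‖u x‖ ≤ ∫ y in (0 : ℝ)..(1 - x), erlangDensity μ n (1 - x - y) * M := by
          rw [h1]
          refine intervalIntegral.norm_integral_le_of_norm_le ht.1
            (Filter.Eventually.of_forall fun y hy => ?_)
            (Continuous.intervalIntegrable (by fun_prop) _ _)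
          have h3 := erlangDensity_nonneg hμ n (sub_nonneg.2 hy.2)
          rw [norm_mul, Complex.norm_real, Real.norm_of_nonneg h3]
          exact mul_le_mul_of_nonneg_left (hFM y ⟨hy.1.le, hy.2.trans ht.2⟩) h3
      _ = erlangCDF μ n (1 - x) * M := h2
      _ ≤ M * c := by
          rw [mul_comm]
          exact mul_le_mul_of_nonneg_left (erlangCDF_le μ hμ hn ht) hM0
  have hF1 : F 1 = 0 := by
    have : lap u 0 = ∫ x in (0 : ℝ)..1, u x := by simp [lap]
    rw [hF]; simp only; rw [← this, hmass]
  -- Total mass zero means `F 1 = 0`, so `F` is recovered by integrating `u` back from `1` over a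
  -- length at most one. Thus `M ≤ M * c` with `c < 1`, which forces `M = 0`.
  have hFc : ∀ x ∈ Set.Icc (0 : ℝ) 1, ‖F x‖ ≤ M * c := by
    intro x hx
    have h1 : F x = -∫ y in x..1, u y := by
      have h2 := intervalIntegral.integral_add_adjacent_intervals (μ := volume) (a := 0) (b := x)
        (c := 1) (hu.intervalIntegrable _ _) (hu.intervalIntegrable _ _)
      have h3 : p + ∫ x in (0 : ℝ)..1, u x = 0 := hF1
      simp only [hF]
      linear_combination h3 + h2
    rw [h1, norm_neg]
    have h2 := intervalIntegral.norm_integral_le_of_norm_le_const (a := x) (b := 1) (f := u)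
      (C := M * c) (fun y hy => by
        rw [Set.uIoc_of_le hx.2] at hy
        exact hu1 y ⟨hx.1.trans hy.1.le, hy.2⟩)
    have h3 : 0 ≤ M * c := (norm_nonneg _).trans (hu1 x hx)
    rw [abs_of_nonneg (by linarith [hx.2])] at h2
    nlinarith [hx.1]
  have hMz : M = 0 := by
    have := hFc x₀ hx₀
    by_contra hne
    have : 0 < M := lt_of_le_of_ne hM0 (Ne.symm hne)
    nlinarith
  refine ⟨?_, fun x hx => ?_⟩
  · have h1 := hFM 0 ⟨le_rfl, zero_le_one⟩
    rw [hMz, norm_le_zero_iff] at h1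
    simpa [hF] using h1
  · have h1 := hu1 x hx
    rw [hMz, zero_mul, norm_le_zero_iff] at h1
    exact h1

/-- `(p, u)` solves the integral equation for the atom at `0` and the density of the stationary
waiting time. -/
structure IsStationarySolution (μ : ℝ) (n : ℕ) (p : ℂ) (u : ℝ → ℂ) : Prop where
  continuous : Continuous u
  mass : p + lap u 0 = 1
  eq_conv : ∀ t ∈ Set.Icc (0 : ℝ) 1, u (1 - t) = erlangConv μ n p u t

theorem IsStationarySolution.unique {μ : ℝ} (hμ : 0 < μ) {n : ℕ} (hn : 1 ≤ n) {p q : ℂ}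
    {u v : ℝ → ℂ} (hu : IsStationarySolution μ n p u) (hv : IsStationarySolution μ n q v) :
    p = q ∧ ∀ x ∈ Set.Icc (0 : ℝ) 1, u x = v x := by
  have huc := hu.continuous
  have hvc := hv.continuous
  have h := eq_zero_of_erlangConv hμ hn (p := p - q) (u := fun x => u x - v x)
    (huc.sub hvc) (by
      rw [lap_sub huc hvc]
      linear_combination hu.mass - hv.mass) (fun t ht => by
      simp only [hu.eq_conv t ht, hv.eq_conv t ht, erlangConv, mul_sub]
      rw [intervalIntegral.integral_sub (Continuous.intervalIntegrable (by fun_prop) _ _)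
        (Continuous.intervalIntegrable (by fun_prop) _ _)]
      ring)
  exact ⟨sub_eq_zero.1 h.1, fun x hx => sub_eq_zero.1 (h.2 x hx)⟩

/-! ### Divisibility, and recovery of the constants from `B` -/

/-- A polynomial that is a continuous multiple of the polynomial `d` is divisible by `d`. -/
theorem dvd_of_eval_mul_continuous (m : Multiset ℂ) (q : Polynomial ℂ) {g : ℂ → ℂ}
    (hg : Continuous g)
    (h : ∀ s, (m.map fun a => Polynomial.X - Polynomial.C a).prod.eval s * g s = q.eval s) :
    (m.map fun a => Polynomial.X - Polynomial.C a).prod ∣ q := by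
  induction m using Multiset.induction_on generalizing q with
  | empty => simp
  | cons a m ih =>
    simp only [Multiset.map_cons, Multiset.prod_cons] at h ⊢
    have ha : q.eval a = 0 := by rw [← h]; simp
    obtain ⟨q', rfl⟩ := Polynomial.dvd_iff_isRoot.2 ha
    refine mul_dvd_mul_left _ (ih q' ?_)
    -- After the factor `X - a` is cancelled off `a`, continuity extends the identity across `a`.
    refine congrFun (eq_of_eq_off_zeros (by fun_prop) (by fun_prop)
      (Polynomial.X_sub_C_ne_zero a) fun s hs => ?_)
    have := h s
    simp only [Polynomial.eval_mul] at this
    rw [mul_assoc] at this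
    exact mul_left_cancel₀ hs this

/-- The polynomial `s (a + s)ⁿ` has degree `n + 1` and divides `q`, whose degree is at most `n`. -/
theorem eq_zero_of_mul_continuous (a : ℂ) {n : ℕ} (q : Polynomial ℂ) (hq : q.natDegree ≤ n)
    {g : ℂ → ℂ} (hg : Continuous g) (h : ∀ s, s * (a + s) ^ n * g s = q.eval s) :
    q = 0 ∧ g = 0 := by
  have hprod : (((0 : ℂ) ::ₘ Multiset.replicate n (-a)).map
      fun a => Polynomial.X - Polynomial.C a).prod
      = Polynomial.X * (Polynomial.X - Polynomial.C (-a)) ^ n := by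
    simp
  have heval : ∀ s, (Polynomial.X * (Polynomial.X - Polynomial.C (-a)) ^ n).eval s
      = s * (a + s) ^ n := by
    intro s; simp [add_comm]
  have hdvd := dvd_of_eval_mul_continuous (0 ::ₘ Multiset.replicate n (-a)) q hg (by
    intro s; rw [hprod, heval, h])
  rw [hprod] at hdvd
  have hD : (Polynomial.X * (Polynomial.X - Polynomial.C (-a)) ^ n).natDegree = n + 1 := by
    rw [Polynomial.natDegree_mul Polynomial.X_ne_zero (pow_ne_zero _ (Polynomial.X_sub_C_ne_zero _)),
      Polynomial.natDegree_pow, Polynomial.natDegree_X_sub_C, Polynomial.natDegree_X]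
    ring
  have hq0 : q = 0 := Polynomial.eq_zero_of_dvd_of_natDegree_lt hdvd (by omega)
  refine ⟨hq0, ?_⟩
  have hD0 : (Polynomial.X * (Polynomial.X - Polynomial.C (-a)) ^ n) ≠ 0 := by
    intro h0; rw [h0] at hD; simp at hD
  refine eq_of_eq_off_zeros hg (continuous_zero) hD0 fun s hs => ?_
  have h1 := h s
  rw [heval] at hs
  rw [hq0, Polynomial.eval_zero] at h1
  exact (mul_eq_zero.1 h1).resolve_left hs

theorem eq_of_binomialSum_eq {n : ℕ} {y z : ℕ → ℂ}
    (h : ∀ i < n, ∑ l ∈ Finset.range (i + 1), (Nat.choose i l : ℂ) * z l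
      = ∑ l ∈ Finset.range (i + 1), (Nat.choose i l : ℂ) * y l) :
    ∀ l < n, z l = y l := by
  intro l
  induction l using Nat.strong_induction_on with
  | _ l ih =>
    intro hl
    have h1 := h l hl
    rw [Finset.sum_range_succ, Finset.sum_range_succ, Nat.choose_self] at h1
    have h2 : ∑ i ∈ Finset.range l, (Nat.choose l i : ℂ) * z i
        = ∑ i ∈ Finset.range l, (Nat.choose l i : ℂ) * y i :=
      Finset.sum_congr rfl fun i hi => by
        rw [Finset.mem_range] at hi
        rw [ih i hi (hi.trans hl)]
    rw [h2] at h1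
    simpa using h1

theorem polyB_injective {μ : ℝ} (hμ : 0 < μ) {n : ℕ} {p : ℂ} {y z : ℕ → ℂ}
    (h : polyB μ n p z = polyB μ n p y) : ∀ l < n, z l = y l := by
  have hμ' : (μ : ℂ) ≠ 0 := by exact_mod_cast hμ.ne'
  set b : (ℕ → ℂ) → ℕ → ℂ := fun y i => ∑ l ∈ Finset.range (i + 1), (Nat.choose i l : ℂ) * y l
    with hb
  suffices hd : ∀ i < n, b z i - b y i = 0 from
    eq_of_binomialSum_eq fun i hi => sub_eq_zero.1 (hd i hi)
  -- The difference of the two polynomials, written in `w = μ + s` and freed of the factors `e^{-μ}`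
  -- and `s = w - μ`.
  let T : Polynomial ℂ := ∑ j ∈ Finset.range n, ∑ i ∈ Finset.range (j + 1),
    Polynomial.C ((μ : ℂ) ^ j / (Nat.factorial i : ℂ) * (b z i - b y i)) *
      Polynomial.X ^ (n - 1 - j + i)
  have hT : T = 0 := by
    refine Polynomial.funext fun w => ?_
    refine congrFun (eq_of_eq_off_zeros (F := fun w => T.eval w)
      (G := fun w => (0 : Polynomial ℂ).eval w) (by fun_prop) (by fun_prop)
      (Polynomial.X_sub_C_ne_zero (μ : ℂ)) fun w hw => ?_) w
    have h1 := congrArg (Polynomial.eval (w - μ)) h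
    rw [polyB_eval, polyB_eval, sub_left_inj] at h1
    have h2 := mul_left_cancel₀ (Complex.exp_ne_zero _) h1
    rw [← sub_eq_zero, ← Finset.sum_sub_distrib] at h2
    have h3 : (w - μ) * T.eval w = 0 := by
      rw [← h2]
      simp only [T, Polynomial.eval_finsetSum, Finset.mul_sum, Polynomial.eval_mul,
        Polynomial.eval_C, Polynomial.eval_pow, Polynomial.eval_X, ← Finset.sum_sub_distrib]
      refine Finset.sum_congr rfl fun j _ => Finset.sum_congr rfl fun i _ => ?_
      simp only [hb, add_sub_cancel]
      ring
    rw [Polynomial.eval_zero]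
    refine (mul_eq_zero.1 h3).resolve_left ?_
    simpa using hw
  -- The system is triangular: in the coefficient of `w^k` the index `i = k - (n - 1 - j)` equals
  -- `k` only for `j = n - 1`, and all other terms have `i < k`.
  intro k
  induction k using Nat.strong_induction_on with
  | _ k ih =>
    intro hk
    have h1 := congrArg (fun q : Polynomial ℂ => q.coeff k) hT
    simp only [T, Polynomial.finsetSum_coeff, Polynomial.coeff_C_mul, Polynomial.coeff_X_pow,
      Polynomial.coeff_zero] at h1
    rw [Finset.sum_eq_single (n - 1), Finset.sum_eq_single k] at h1
    · simpa [hμ', Nat.factorial_ne_zero] using h1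
    · intro i hi hik
      rw [if_neg (by omega)]; simp
    · intro hk'
      rw [Finset.mem_range] at hk'; omega
    · intro j hj hjn
      rw [Finset.mem_range] at hj
      refine Finset.sum_eq_zero fun i hi => ?_
      split_ifs with hi'
      · rw [ih i (by omega) (by omega)]; simp
      · simp
    · intro hn'
      rw [Finset.mem_range] at hn'; omega

/-! ### The linear system and its equivalence with the integral equation -/

/-- The left-hand side of the linear equations for the constants. -/
def linSys (μ : ℝ) (n : ℕ) (p : ℂ) (y : ℕ → ℂ) (s : ℂ) : ℂ :=
  Complex.exp (-s) * s * ((μ : ℂ) + s) ^ n * funA μ n p y (-s) + (μ : ℂ) ^ n * funA μ n p y s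

theorem polyP_add_polyQ_eq_neg_linSys (μ : ℝ) (n : ℕ) (p : ℂ) (y : ℕ → ℂ) (s : ℂ) :
    (polyP μ n p y).eval s + Complex.exp (-s) * (polyQ μ n p y).eval s = -linSys μ n p y s := by
  rw [← polyP_add_polyQ, linSys]; ring

theorem polyR_eval_eq_mul (μ : ℝ) (n : ℕ) (s : ℂ) :
    (polyR μ n).eval s = s ^ 2 * (((μ : ℂ) + s) ^ n * ((μ : ℂ) - s) ^ n) + (μ : ℂ) ^ n * (μ : ℂ) ^ n := by
  rw [polyR_eval, ← mul_pow, two_mul, pow_add]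
  ring_nf

/-- Writing `L` for `linSys`, one has `μⁿ L(-s) = -e^s s (μ - s)ⁿ L(s) + R(s) A(-s)`. Hence one
equation from each companion pair suffices. -/
theorem linSys_neg {μ : ℝ} (hμ : 0 < μ) {n : ℕ} {p : ℂ} {y : ℕ → ℂ} {s : ℂ}
    (hs : (polyR μ n).eval s = 0) (h : linSys μ n p y s = 0) : linSys μ n p y (-s) = 0 := by
  have hμ' : (μ : ℂ) ^ n ≠ 0 := pow_ne_zero _ (by exact_mod_cast hμ.ne')
  have he : Complex.exp s * Complex.exp (-s) = 1 := by rw [← Complex.exp_add]; simp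
  rw [polyR_eval_eq_mul] at hs
  refine (mul_eq_zero.1 (?_ : (μ : ℂ) ^ n * _ = 0)).resolve_left hμ'
  simp only [linSys, neg_neg, ← sub_eq_add_neg] at h ⊢
  linear_combination (-(Complex.exp s * s * ((μ : ℂ) - s) ^ n)) * h
    + funA μ n p y (-s) * hs
    + s ^ 2 * ((μ : ℂ) + s) ^ n * ((μ : ℂ) - s) ^ n * funA μ n p y (-s) * he

theorem linSys_eq_zero_of_half {μ : ℝ} (hμ : 0 < μ) {n : ℕ} {p : ℂ} {y : ℕ → ℂ}
    {r : Fin (2 * n + 2) → ℂ} (hr : IsZeroEnumeration μ n r)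
    (h : ∀ i : Fin (2 * n + 2), (i : ℕ) < n + 1 → linSys μ n p y (r i) = 0) (i) :
    linSys μ n p y (r i) = 0 := by
  by_cases hi : (i : ℕ) < n + 1
  · exact h i hi
  · have h1 := linSys_neg hμ (hr.eval_eq_zero i.rev) (h i.rev (by rw [Fin.val_rev]; omega))
    rwa [← hr.companion, Fin.rev_rev] at h1

theorem IsStationarySolution.polyR_mul_lap {μ : ℝ} {n : ℕ} (hn : 1 ≤ n) {p : ℂ} {u : ℝ → ℂ}
    (hu : IsStationarySolution μ n p u) (s : ℂ) :
    (polyR μ n).eval s * lap u s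
      = -linSys μ n p (fun l => lapDeriv l u (-(μ : ℂ))) s := by
  -- The transformed integral equation; evaluated at `s` and at `-s` it allows `lap u (-s)` to be
  -- eliminated.
  have key : ∀ s, s * ((μ : ℂ) + s) ^ n * (Complex.exp (-s) * lap u (-s)) - (μ : ℂ) ^ n * lap u s
      = funA μ n p (fun l => lapDeriv l u (-(μ : ℂ))) s := by
    intro s
    have h1 := lap_erlangConv_eq μ hn p hu.continuous s
    rw [← lap_congr hu.eq_conv, lap_comp_one_sub] at h1
    rw [funA_eq, h1]
    linear_combination (-(Complex.exp (-s) * ((μ : ℂ) + s) ^ n)) * hu.mass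
  have he : Complex.exp s * Complex.exp (-s) = 1 := by rw [← Complex.exp_add]; simp
  have h2 := key (-s)
  simp only [neg_neg, ← sub_eq_add_neg] at h2
  rw [linSys, ← key s, ← h2, polyR_eval_eq_mul]
  linear_combination (-(s ^ 2 * (((μ : ℂ) + s) ^ n * ((μ : ℂ) - s) ^ n) * lap u s)) * he

theorem IsStationarySolution.linSys_eq_zero {μ : ℝ} {n : ℕ} (hn : 1 ≤ n) {p : ℂ} {u : ℝ → ℂ}
    (hu : IsStationarySolution μ n p u) {s : ℂ} (hs : (polyR μ n).eval s = 0) :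
    linSys μ n p (fun l => lapDeriv l u (-(μ : ℂ))) s = 0 := by
  have := hu.polyR_mul_lap hn s
  rw [hs, zero_mul] at this
  exact neg_eq_zero.1 this.symm

theorem IsStationarySolution.lap_eq {μ : ℝ} {n : ℕ} (hn : 1 ≤ n) {p : ℂ} {u : ℝ → ℂ}
    (hu : IsStationarySolution μ n p u) {r : Fin (2 * n + 2) → ℂ} (hr : IsZeroEnumeration μ n r) :
    lap u = lap (expSum μ n p (fun l => lapDeriv l u (-(μ : ℂ))) r) := by
  refine eq_of_eq_off_zeros (continuous_lap hu.continuous) (continuous_lap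
    (continuous_expSum _ _ _ _ _)) (polyR_ne_zero μ n) fun s hs => mul_left_cancel₀ hs ?_
  rw [lap_expSum_eq _ _ hr, polyP_add_polyQ_eq_neg_linSys, hu.polyR_mul_lap hn]
  intro i
  rw [polyP_add_polyQ_eq_neg_linSys, hu.linSys_eq_zero hn (hr.eval_eq_zero i), neg_zero]

theorem IsStationarySolution.eq_expSum {μ : ℝ} {n : ℕ} (hn : 1 ≤ n) {p : ℂ} {u : ℝ → ℂ}
    (hu : IsStationarySolution μ n p u) {r : Fin (2 * n + 2) → ℂ} (hr : IsZeroEnumeration μ n r) :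
    ∀ x ∈ Set.Icc (0 : ℝ) 1, u x = expSum μ n p (fun l => lapDeriv l u (-(μ : ℂ))) r x := by
  have hg := continuous_expSum μ n p (fun l => lapDeriv l u (-(μ : ℂ))) r
  intro x hx
  refine sub_eq_zero.1 (eq_zero_of_lap_eq_zero (hu.continuous.sub hg) (fun s => ?_) x hx)
  have h := lap_sub hu.continuous hg s
  rw [hu.lap_eq hn hr, sub_self] at h
  exact h

theorem IsStationarySolution.atom_eq {μ : ℝ} (hμ : 0 < μ) {n : ℕ} (hn : 1 ≤ n) {p : ℂ}
    {u : ℝ → ℂ} (hu : IsStationarySolution μ n p u) {r : Fin (2 * n + 2) → ℂ}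
    (hr : IsZeroEnumeration μ n r) :
    p = 1 + ∑ i, coeffC μ n p (fun l => lapDeriv l u (-(μ : ℂ))) (r i) / r i *
      (1 - Complex.exp (r i)) := by
  have h := hu.mass
  rw [hu.lap_eq hn hr, lap_expSum] at h
  set y : ℕ → ℂ := fun l => lapDeriv l u (-(μ : ℂ))
  have hs : ∑ i, coeffC μ n p y (r i) / r i * (1 - Complex.exp (r i))
      = -∑ i, coeffC μ n p y (r i) * lap (fun x => Complex.exp (r i * (x : ℂ))) 0 := by
    rw [← Finset.sum_neg_distrib]
    refine Finset.sum_congr rfl fun i _ => ?_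
    have h0 := polyR_root_ne_zero hμ (hr.eval_eq_zero i)
    have h1 := lap_exp (r i) 0
    rw [sub_zero, zero_sub] at h1
    rw [← h1]
    field_simp
  rw [hs]
  linear_combination h

/-- Every solution of the linear equations comes from a solution of the integral equation. -/
theorem isStationarySolution_expSum {μ : ℝ} (hμ : 0 < μ) {n : ℕ} (hn : 1 ≤ n) {p : ℂ} {z : ℕ → ℂ}
    {r : Fin (2 * n + 2) → ℂ} (hr : IsZeroEnumeration μ n r)
    (h : ∀ i, linSys μ n p z (r i) = 0) :
    IsStationarySolution μ n p (expSum μ n p z r) ∧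
      ∀ l < n, z l = lapDeriv l (expSum μ n p z r) (-(μ : ℂ)) := by
  have hμ' : (μ : ℂ) ^ n ≠ 0 := pow_ne_zero _ (by exact_mod_cast hμ.ne')
  set g := expSum μ n p z r with hg
  have hgc : Continuous g := continuous_expSum _ _ _ _ _
  have hlap : ∀ s, (polyR μ n).eval s * lap g s = -linSys μ n p z s := fun s => by
    rw [hg, lap_expSum_eq _ _ hr, polyP_add_polyQ_eq_neg_linSys]
    intro i
    rw [polyP_add_polyQ_eq_neg_linSys, h i, neg_zero]
  have hfA : Continuous (funA μ n p z) := by unfold funA; fun_prop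
  have hlc := continuous_lap hgc
  -- The elimination is reversed: the formulas for `R * lap g` at `s` and `-s` return the functional
  -- equation off the zeros of `R`, and continuity extends it.
  have key : ∀ s, s * ((μ : ℂ) + s) ^ n * (Complex.exp (-s) * lap g (-s)) - (μ : ℂ) ^ n * lap g s
      = funA μ n p z s := by
    refine congrFun (eq_of_eq_off_zeros (by fun_prop) hfA (polyR_ne_zero μ n) fun s hs => ?_)
    refine mul_left_cancel₀ hs ?_
    have h1 := hlap s
    have h2 := hlap (-s)
    have he : Complex.exp s * Complex.exp (-s) = 1 := by rw [← Complex.exp_add]; simp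
    have hR := polyR_eval_eq_mul μ n s
    rw [polyR_eval_neg] at h2
    simp only [linSys, neg_neg, ← sub_eq_add_neg] at h1 h2
    linear_combination s * ((μ : ℂ) + s) ^ n * Complex.exp (-s) * h2 - (μ : ℂ) ^ n * h1
      - funA μ n p z s * hR
      + s ^ 2 * ((μ : ℂ) + s) ^ n * ((μ : ℂ) - s) ^ n * funA μ n p z s * he
  set y : ℕ → ℂ := fun l => lapDeriv l g (-(μ : ℂ)) with hy
  set κ := 1 - p - lap g 0 with hκ
  -- This is `e^s s (μ + s)ⁿ` times the transform of the defect of `g` in the integral equation.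
  let q : Polynomial ℂ := polyB μ n p z - polyB μ n p y -
    Polynomial.C κ * (Polynomial.C (μ : ℂ) + Polynomial.X) ^ n
  have hqdeg : q.natDegree ≤ n := by
    refine (Polynomial.natDegree_sub_le _ _).trans (max_le
      ((Polynomial.natDegree_sub_le _ _).trans (max_le ?_ ?_)) ?_)
    · exact polyB_natDegree_le _ _ _ _
    · exact polyB_natDegree_le _ _ _ _
    · exact (Polynomial.natDegree_C_mul_le _ _).trans (natDegree_C_add_X_pow_le _ _)
  have hconv := continuous_erlangConv μ n p hgc
  have hd : Continuous fun t => g (1 - t) - erlangConv μ n p g t := by fun_prop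
  have hdl := continuous_lap hd
  obtain ⟨hq0, hG0⟩ := eq_zero_of_mul_continuous (μ : ℂ) q hqdeg
    (g := fun s => Complex.exp s * lap (fun t => g (1 - t) - erlangConv μ n p g t) s)
    (by fun_prop) (by
      intro s
      have he : Complex.exp s * Complex.exp (-s) = 1 := by rw [← Complex.exp_add]; simp
      have h1 := lap_erlangConv_eq μ hn p hgc s
      have h2 := key s
      rw [funA_eq] at h2
      rw [lap_sub (by fun_prop) hconv, lap_comp_one_sub]
      simp only [q, Polynomial.eval_sub, Polynomial.eval_mul, Polynomial.eval_C,
        Polynomial.eval_pow, Polynomial.eval_add, Polynomial.eval_X]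
      linear_combination Complex.exp s * h2 - Complex.exp s * h1 +
        ((polyB μ n p z).eval s - (polyB μ n p y).eval s - κ * ((μ : ℂ) + s) ^ n) * he)
  -- At `s = 0` both `B` terms equal `-μⁿ`, so `q(0) = -κ μⁿ`; its vanishing gives total mass one.
  have hκ0 : κ = 0 := by
    have h1 := congrArg (Polynomial.eval 0) hq0
    simp only [q, Polynomial.eval_sub, polyB_eval, Polynomial.eval_mul, Polynomial.eval_C,
        Polynomial.eval_pow, Polynomial.eval_add, Polynomial.eval_X] at h1
    simpa [hμ.ne'] using h1
  have hB : polyB μ n p z = polyB μ n p y := by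
    have h1 := hq0
    simp only [q, hκ0, Polynomial.C_0, zero_mul, sub_zero] at h1
    exact sub_eq_zero.1 h1
  refine ⟨⟨hgc, ?_, fun t ht => ?_⟩, polyB_injective hμ hB⟩
  · linear_combination -hκ0
  · refine sub_eq_zero.1 (eq_zero_of_lap_eq_zero hd (fun s => ?_) t ht)
    exact (mul_eq_zero.1 (congrFun hG0 s)).resolve_left (Complex.exp_ne_zero s)

theorem funA_congr (μ : ℝ) {n : ℕ} (p : ℂ) {y z : ℕ → ℂ} (h : ∀ l < n, z l = y l) (s : ℂ) :
    funA μ n p z s = funA μ n p y s := by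
  unfold funA
  congr 2
  refine Finset.sum_congr rfl fun j hj => Finset.sum_congr rfl fun i hi =>
    Finset.sum_congr rfl fun l hl => ?_
  rw [Finset.mem_range] at hj hi hl
  rw [h l (by omega)]

theorem IsStationarySolution.linSys_iff {μ : ℝ} (hμ : 0 < μ) {n : ℕ} (hn : 1 ≤ n) {p₀ : ℂ}
    {u : ℝ → ℂ} (hu : IsStationarySolution μ n p₀ u) {r : Fin (2 * n + 2) → ℂ}
    (hr : IsZeroEnumeration μ n r) (p : ℂ) (z : ℕ → ℂ) :
    (∀ i : Fin (2 * n + 2), (i : ℕ) < n + 1 → linSys μ n p z (r i) = 0) ↔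
      (p = p₀ ∧ ∀ l < n, z l = lapDeriv l u (-(μ : ℂ))) := by
  constructor
  · intro h
    obtain ⟨hg, hz⟩ := isStationarySolution_expSum hμ hn hr (linSys_eq_zero_of_half hμ hr h)
    obtain ⟨hp, hgu⟩ := hg.unique hμ hn hu
    refine ⟨hp, fun l hl => ?_⟩
    rw [hz l hl, lapDeriv_congr hgu]
  · rintro ⟨rfl, hz⟩ i -
    have h1 := hu.linSys_eq_zero hn (hr.eval_eq_zero i)
    rw [linSys] at h1 ⊢
    rwa [funA_congr μ p hz, funA_congr μ p hz]

/-! ### From the random variables to the integral equation -/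

section Probability

variable {Ω : Type*} [MeasurableSpace Ω] {Pr : Measure Ω} {μ : ℝ} {n : ℕ} {W P R : Ω → ℝ}

theorem IsDensityOnUnitInterval.integral_eq [IsProbabilityMeasure Pr] {f : ℝ → ℝ}
    (hf : IsDensityOnUnitInterval Pr W f) (hfc : Continuous f) (hWm : Measurable W) {φ : ℝ → ℝ}
    (hφ : Continuous φ) {C : ℝ} (hC : ∀ x, ‖φ x‖ ≤ C) :
    ∫ ω, φ (W ω) ∂Pr = Pr.real {ω | W ω = 0} * φ 0 + ∫ y in (0 : ℝ)..1, φ y * f y := by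
  have : IsProbabilityMeasure (Pr.map W) := Measure.isProbabilityMeasure_map hWm.aemeasurable
  have hint : Integrable φ (Pr.map W) :=
    Integrable.of_bound hφ.aestronglyMeasurable C (Filter.Eventually.of_forall hC)
  rw [← integral_map (φ := W) hWm.aemeasurable hφ.aestronglyMeasurable]
  rw [hf.law_eq] at hint ⊢
  rw [integral_add_measure hint.left_of_add_measure hint.right_of_add_measure,
    integral_smul_measure, integral_dirac, smul_eq_mul]
  congr 1
  rw [integral_withDensity_eq_integral_toReal_smul (by fun_prop)
    (Filter.Eventually.of_forall fun x => ENNReal.ofReal_lt_top), integral_Icc_eq_integral_Ioc,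
    intervalIntegral.integral_of_le zero_le_one]
  refine setIntegral_congr_fun measurableSet_Ioc fun x hx => ?_
  simp only [smul_eq_mul]
  rw [ENNReal.toReal_ofReal (hf.nonneg x ⟨hx.1.le, hx.2⟩), mul_comm]

namespace IsStationaryWaitingTime

theorem measureReal_le (hW : IsStationaryWaitingTime Pr μ n W P R)
    [IsProbabilityMeasure Pr] (hn : 1 ≤ n) (x : ℝ) :
    Pr.real {ω | P ω ≤ x} = erlangExt μ n x := by
  rcases le_total 0 x with hx | hx
  · rw [hW.erlang x hx, erlangExt_of_nonneg μ n hx]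
  · rw [erlangExt_of_nonpos μ hn hx]
    have h0 := hW.erlang 0 le_rfl
    rw [erlangCDF_zero μ hn] at h0
    refine le_antisymm ?_ measureReal_nonneg
    rw [← h0]
    exact measureReal_mono fun ω hω => le_trans hω hx

theorem erlangExt_nonneg (hW : IsStationaryWaitingTime Pr μ n W P R)
    [IsProbabilityMeasure Pr] (hn : 1 ≤ n) (x : ℝ) :
    0 ≤ erlangExt μ n x := by
  rw [← hW.measureReal_le hn]; exact measureReal_nonneg

theorem erlangExt_le_one (hW : IsStationaryWaitingTime Pr μ n W P R)
    [IsProbabilityMeasure Pr] (hn : 1 ≤ n) (x : ℝ) :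
    erlangExt μ n x ≤ 1 := by
  rw [← hW.measureReal_le hn]; exact measureReal_le_one

theorem norm_erlangExt_le (hW : IsStationaryWaitingTime Pr μ n W P R)
    [IsProbabilityMeasure Pr] (hn : 1 ≤ n) (x : ℝ) :
    ‖erlangExt μ n x‖ ≤ 1 := by
  rw [Real.norm_of_nonneg (hW.erlangExt_nonneg hn x)]
  exact hW.erlangExt_le_one hn x

theorem ae_nonneg_wait (hW : IsStationaryWaitingTime Pr μ n W P R) : ∀ᵐ ω ∂Pr, 0 ≤ W ω :=
  hW.stationary.symm.ae_mem_snd (t := Set.Ici 0) measurableSet_Ici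
    (Filter.Eventually.of_forall fun _ => Set.mem_Ici.2 (le_max_left _ _))

/-- The distribution function is prescribed only on `[0, ∞)`; its value `0` at `0` already excludes
negative pick times almost surely. -/
theorem ae_nonneg_pick (hW : IsStationaryWaitingTime Pr μ n W P R)
    [IsProbabilityMeasure Pr] (hn : 1 ≤ n) : ∀ᵐ ω ∂Pr, 0 ≤ P ω := by
  have h := hW.measureReal_le hn 0
  rw [erlangExt_of_nonpos μ hn le_rfl, measureReal_eq_zero_iff] at h
  rw [ae_iff]
  exact measure_mono_null (fun ω hω => (not_le.1 hω).le) h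

end IsStationaryWaitingTime

/-- The density of the waiting time: `x ↦ Pr[P + W ≤ 1 - x]`. -/
def waitDensity (Pr : Measure Ω) (μ : ℝ) (n : ℕ) (W : Ω → ℝ) (x : ℝ) : ℝ :=
  ∫ ω, erlangExt μ n (1 - x - W ω) ∂Pr

namespace IsStationaryWaitingTime

theorem integrable_erlangExt (hW : IsStationaryWaitingTime Pr μ n W P R)
    [IsProbabilityMeasure Pr] (hn : 1 ≤ n) (t : ℝ) :
    Integrable (fun ω => erlangExt μ n (t - W ω)) Pr := by
  have hWm := hW.measurable_W
  have hm : Measurable (erlangExt μ n) := (continuous_erlangExt μ n).measurable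
  exact Integrable.of_bound (by fun_prop) 1
    (Filter.Eventually.of_forall fun _ => hW.norm_erlangExt_le hn _)

theorem continuous_waitDensity (hW : IsStationaryWaitingTime Pr μ n W P R)
    [IsProbabilityMeasure Pr] (hn : 1 ≤ n) :
    Continuous (waitDensity Pr μ n W) := by
  refine continuous_of_dominated (bound := fun _ => 1)
    (fun x => (hW.integrable_erlangExt hn _).aestronglyMeasurable)
    (fun x => Filter.Eventually.of_forall fun _ => hW.norm_erlangExt_le hn _)
    (integrable_const _) (Filter.Eventually.of_forall fun ω => ?_)
  fun_prop

theorem waitDensity_nonneg (hW : IsStationaryWaitingTime Pr μ n W P R)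
    [IsProbabilityMeasure Pr] (hn : 1 ≤ n) (x : ℝ) :
    0 ≤ waitDensity Pr μ n W x :=
  integral_nonneg fun _ => hW.erlangExt_nonneg hn _

theorem measure_add_le (hW : IsStationaryWaitingTime Pr μ n W P R)
    [IsProbabilityMeasure Pr] (hn : 1 ≤ n) (x : ℝ) :
    Pr {ω | W ω + P ω ≤ 1 - x} = ENNReal.ofReal (waitDensity Pr μ n W x) := by
  have hWm := hW.measurable_W
  have hPm := hW.measurable_P
  have hind : IndepFun W P Pr := hW.indep.indepFun (i := 0) (j := 1) (by decide)
  have hS : MeasurableSet {q : ℝ × ℝ | q.1 + q.2 ≤ 1 - x} :=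
    measurableSet_le (by fun_prop) (by fun_prop)
  have h1 : Pr {ω | W ω + P ω ≤ 1 - x}
      = (Pr.map fun ω => (W ω, P ω)) {q : ℝ × ℝ | q.1 + q.2 ≤ 1 - x} := by
    rw [Measure.map_apply (by fun_prop) hS]; rfl
  rw [h1, (indepFun_iff_map_prod_eq_prod_map_map hWm.aemeasurable hPm.aemeasurable).1 hind,
    Measure.prod_apply hS, waitDensity,
    ofReal_integral_eq_lintegral_ofReal (hW.integrable_erlangExt hn _)
      (Filter.Eventually.of_forall fun _ => hW.erlangExt_nonneg hn _),
    lintegral_map (measurable_measure_prodMk_left hS) hWm]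
  refine lintegral_congr fun ω => ?_
  rw [← hW.measureReal_le hn, ofReal_measureReal, Measure.map_apply hPm (measurable_prodMk_left hS)]
  congr 1
  ext ω'
  simp only [Set.mem_preimage, Set.mem_ofPred_eq]
  constructor <;> intro h <;> linarith

theorem map_rotation (hW : IsStationaryWaitingTime Pr μ n W P R) : Pr.map R = volume.restrict (Set.Ioc (0 : ℝ) 1) := by
  have h := hW.uniform
  rw [pdf.IsUniform, ProbabilityTheory.cond] at h
  rw [h, Real.volume_Ico]
  simp only [sub_zero, ENNReal.ofReal_one, inv_one, one_smul]
  exact Measure.restrict_congr_set Ico_ae_eq_Ioc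

theorem measure_sub_mem (hW : IsStationaryWaitingTime Pr μ n W P R)
    [IsProbabilityMeasure Pr] (hn : 1 ≤ n) {C : Set ℝ} (hC : MeasurableSet C)
    (hpos : ∀ x ∈ C, 0 < x) :
    Pr {ω | R ω - P ω - W ω ∈ C}
      = ∫⁻ x in C, (Set.Ioc (0 : ℝ) 1).indicator
          (fun x => ENNReal.ofReal (waitDensity Pr μ n W x)) x := by
  have hWm := hW.measurable_W
  have hPm := hW.measurable_P
  have hRm := hW.measurable_R
  set D : Ω → ℝ := fun ω => W ω + P ω with hD
  have hDm : Measurable D := by fun_prop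
  have hind : IndepFun D R Pr := by
    have h := hW.indep.indepFun_prodMk (i := 0) (j := 1) (k := 2)
      (by intro i; fin_cases i <;> assumption) (by decide) (by decide)
    exact h.comp (φ := fun q : ℝ × ℝ => q.1 + q.2) (ψ := id) (by fun_prop) measurable_id
  have hmap := (indepFun_iff_map_prod_eq_prod_map_map hDm.aemeasurable hRm.aemeasurable).1 hind
  have hS : MeasurableSet {q : ℝ × ℝ | q.2 - q.1 ∈ C} :=
    (show Measurable fun q : ℝ × ℝ => q.2 - q.1 by fun_prop) hC
  have : IsProbabilityMeasure (Pr.map D) := Measure.isProbabilityMeasure_map hDm.aemeasurable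
  have h1 : Pr {ω | R ω - P ω - W ω ∈ C} = (Pr.map fun ω => (D ω, R ω)) {q | q.2 - q.1 ∈ C} := by
    rw [Measure.map_apply (by fun_prop) hS]
    congr 1
    ext ω
    simp only [Set.mem_preimage, Set.mem_ofPred_eq, hD]
    rw [sub_sub, add_comm]
  rw [h1, hmap, hW.map_rotation, Measure.prod_apply hS]
  have hT : MeasurableSet {q : ℝ × ℝ | q.2 ∈ C ∧ q.2 + q.1 ∈ Set.Ioc (0 : ℝ) 1} :=
    (measurable_snd hC).inter
      ((show Measurable fun q : ℝ × ℝ => q.2 + q.1 by fun_prop) measurableSet_Ioc)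
  -- Translation invariance substitutes `x = r - d`. The resulting set is symmetric enough for
  -- Fubini: slicing it at fixed `x` gives the density.
  have h2 : ∀ d : ℝ, (volume.restrict (Set.Ioc (0 : ℝ) 1)) (Prod.mk d ⁻¹' {q | q.2 - q.1 ∈ C})
      = volume (Prod.mk d ⁻¹' {q : ℝ × ℝ | q.2 ∈ C ∧ q.2 + q.1 ∈ Set.Ioc (0 : ℝ) 1}) := by
    intro d
    rw [Measure.restrict_apply (measurable_prodMk_left hS), ← measure_preimage_add_right volume d]
    congr 1
    ext x
    change x + d - d ∈ C ∧ x + d ∈ Set.Ioc (0 : ℝ) 1 ↔ x ∈ C ∧ x + d ∈ Set.Ioc (0 : ℝ) 1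
    rw [add_sub_cancel_right]
  simp only [h2]
  rw [← Measure.prod_apply hT, Measure.prod_apply_symm hT, ← lintegral_indicator hC]
  refine lintegral_congr fun x => ?_
  rw [Measure.map_apply hDm (measurable_prodMk_right hT)]
  by_cases hx : x ∈ C
  · rw [Set.indicator_of_mem hx]
    have hx0 := hpos x hx
    -- As `x > 0` and `W + P ≥ 0` almost surely, the lower bound `0 < x + W + P` holds
    -- automatically.
    have hae : (D ⁻¹' ((fun d => (d, x)) ⁻¹' {q : ℝ × ℝ | q.2 ∈ C ∧ q.2 + q.1 ∈ Set.Ioc (0 : ℝ) 1})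
        : Set Ω) =ᵐ[Pr] {ω | W ω + P ω ≤ 1 - x} := by
      filter_upwards [hW.ae_nonneg_wait, hW.ae_nonneg_pick hn] with ω h3 h4
      refine propext ⟨fun h => ?_, fun h => ⟨hx, ?_, ?_⟩⟩
      · have h5 : x + (W ω + P ω) ≤ 1 := h.2.2
        change W ω + P ω ≤ 1 - x
        linarith
      · change 0 < x + (W ω + P ω); linarith
      · have h5 : W ω + P ω ≤ 1 - x := h
        change x + (W ω + P ω) ≤ 1; linarith
    rw [measure_congr hae]
    by_cases hx1 : x ≤ 1
    · rw [Set.indicator_of_mem (show x ∈ Set.Ioc (0 : ℝ) 1 from ⟨hx0, hx1⟩),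
        hW.measure_add_le hn]
    · rw [Set.indicator_of_notMem (fun h => hx1 h.2)]
      have : ∀ᵐ ω ∂Pr, ¬ (W ω + P ω ≤ 1 - x) := by
        filter_upwards [hW.ae_nonneg_wait, hW.ae_nonneg_pick hn] with ω h3 h4
        linarith
      simpa [ae_iff] using this
  · rw [Set.indicator_of_notMem hx]
    convert measure_empty (μ := Pr)
    ext ω
    simp [hx]

theorem isDensityOnUnitInterval (hW : IsStationaryWaitingTime Pr μ n W P R)
    [IsProbabilityMeasure Pr] (hn : 1 ≤ n) :
    IsDensityOnUnitInterval Pr W (waitDensity Pr μ n W) where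
  continuousOn := (hW.continuous_waitDensity hn).continuousOn
  nonneg x _ := hW.waitDensity_nonneg hn x
  law_eq := by
    have hWm := hW.measurable_W
    have hPm := hW.measurable_P
    have hRm := hW.measurable_R
    have hm0 : MeasurableSet ({0} : Set ℝ) := measurableSet_singleton 0
    ext B hB
    rw [Measure.add_apply, Measure.smul_apply, Measure.dirac_apply' _ hB, withDensity_apply _ hB,
      ← measure_inter_add_sdiff B hm0]
    congr 1
    · rw [Measure.map_apply hWm (hB.inter hm0)]
      by_cases h0 : (0 : ℝ) ∈ B
      · rw [Set.indicator_of_mem h0, Set.inter_eq_right.2 (Set.singleton_subset_iff.2 h0)]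
        simp only [Pi.one_apply, smul_eq_mul, mul_one]
        rfl
      · rw [Set.indicator_of_notMem h0, smul_zero, Set.inter_singleton_eq_empty.2 h0]
        simp
    · rw [hW.stationary.map_eq, Measure.map_apply (by fun_prop) (hB.diff hm0)]
      -- Away from the atom the positive part plays no role.
      have h1 : (fun ω => max 0 (R ω - P ω - W ω)) ⁻¹' (B \ {0})
          = {ω | R ω - P ω - W ω ∈ B ∩ Set.Ioi 0} := by
        ext ω
        simp only [Set.mem_preimage, Set.mem_sdiff, Set.mem_singleton_iff, Set.mem_ofPred_eq,
          Set.mem_inter_iff, Set.mem_Ioi]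
        rcases le_or_gt (R ω - P ω - W ω) 0 with h | h
        · simp [max_eq_left h, not_lt.2 h]
        · simp [max_eq_right h.le, h, h.ne']
      rw [h1, hW.measure_sub_mem hn (hB.inter measurableSet_Ioi) (fun x hx => hx.2),
        setLIntegral_indicator measurableSet_Ioc, Measure.restrict_restrict hB]
      refine setLIntegral_congr ?_
      have h2 : Set.Ioc (0 : ℝ) 1 ∩ (B ∩ Set.Ioi 0) = B ∩ Set.Ioc 0 1 := by
        ext x
        simp only [Set.mem_inter_iff, Set.mem_Ioc, Set.mem_Ioi]
        tauto
      rw [h2]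
      exact (Filter.EventuallyEq.refl _ _).inter Ioc_ae_eq_Icc

theorem isStationarySolution (hW : IsStationaryWaitingTime Pr μ n W P R)
    [IsProbabilityMeasure Pr] (hn : 1 ≤ n) :
    IsStationarySolution μ n (Pr.real {ω | W ω = 0} : ℝ)
      (fun x => (waitDensity Pr μ n W x : ℂ)) where
  continuous := Complex.continuous_ofReal.comp (hW.continuous_waitDensity hn)
  mass := by
    have h := (hW.isDensityOnUnitInterval hn).integral_eq (hW.continuous_waitDensity hn)
      hW.measurable_W (φ := fun _ => 1) continuous_const (C := 1) (by simp)
    simp only [integral_const, probReal_univ, smul_eq_mul, mul_one, one_mul] at h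
    have h1 : lap (fun x => (waitDensity Pr μ n W x : ℂ)) 0
        = ((∫ y in (0 : ℝ)..1, waitDensity Pr μ n W y : ℝ) : ℂ) := by
      rw [← intervalIntegral.integral_ofReal]
      simp [lap]
    rw [h1, ← Complex.ofReal_add, ← h, Complex.ofReal_one]
  eq_conv t _ := by
    -- The density at `1 - t` is the expectation of `G(t - W)`; evaluating it with the law of `W`
    -- itself closes the equation.
    have h := (hW.isDensityOnUnitInterval hn).integral_eq (hW.continuous_waitDensity hn)
      hW.measurable_W (φ := fun w => erlangExt μ n (t - w)) (by fun_prop) (C := 1)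
      (fun _ => hW.norm_erlangExt_le hn _)
    rw [waitDensity, sub_sub_cancel, h, sub_zero, erlangConv]
    push_cast
    rw [← intervalIntegral.integral_ofReal]
    push_cast
    rfl

end IsStationaryWaitingTime

end Probability

end

end Carousel

theorem mainTheorem1 (μ : ℝ) (hμ : 0 < μ) (n : ℕ) (hn : 1 ≤ n)
    {Ω : Type*} [MeasurableSpace Ω] (Pr : Measure Ω) [IsProbabilityMeasure Pr]
    (W P R : Ω → ℝ) (hW : Carousel.IsStationaryWaitingTime Pr μ n W P R) :
    (∃ r : Fin (2 * n + 2) → ℂ, Carousel.IsZeroEnumeration μ n r) ∧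
    (∀ s : ℂ, (Carousel.polyR μ n).eval s = 0 →
      s ≠ 0 ∧ (Carousel.polyR μ n).derivative.eval s ≠ 0) ∧
    ∃ f : ℝ → ℝ, Carousel.IsDensityOnUnitInterval Pr W f ∧
      ∀ (π₀ : ℝ) (y : ℕ → ℂ), π₀ = Pr.real {ω | W ω = 0} →
        (∀ l, y l = iteratedDeriv l (Carousel.unitLaplace f) (-(μ : ℂ))) →
        ∀ r : Fin (2 * n + 2) → ℂ, Carousel.IsZeroEnumeration μ n r →
          -- the density
          (∀ x ∈ Set.Icc (0 : ℝ) 1,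
            (f x : ℂ) = ∑ i, Carousel.coeffC μ n π₀ y (r i) * Complex.exp (r i * (x : ℂ))) ∧
          -- the atom at the origin
          (π₀ : ℂ) = 1 + ∑ i, Carousel.coeffC μ n π₀ y (r i) / r i * (1 - Complex.exp (r i)) ∧
          -- the constants that enter the coefficients are the unique solution of a linear system
          (∀ (p : ℂ) (z : ℕ → ℂ),
            (∀ i : Fin (2 * n + 2), (i : ℕ) < n + 1 →
              Complex.exp (-r i) * r i * ((μ : ℂ) + r i) ^ n * Carousel.funA μ n p z (-r i)
                + (μ : ℂ) ^ n * Carousel.funA μ n p z (r i) = 0) ↔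
            (p = π₀ ∧ ∀ l < n, z l = y l)) := by
  refine ⟨Carousel.exists_isZeroEnumeration hμ hn, fun s hs =>
    ⟨Carousel.polyR_root_ne_zero hμ hs, Carousel.polyR_derivative_ne_zero hμ hn hs⟩,
    Carousel.waitDensity Pr μ n W, hW.isDensityOnUnitInterval hn, ?_⟩
  rintro π₀ y rfl hy r hr
  have hu := hW.isStationarySolution hn
  obtain rfl : y = fun l => Carousel.lapDeriv l
      (fun x => (Carousel.waitDensity Pr μ n W x : ℂ)) (-(μ : ℂ)) := by
    funext l
    rw [hy l]
    exact congrFun (Carousel.iteratedDeriv_lap hu.continuous l) _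
  exact ⟨hu.eq_expSum hn hr, hu.atom_eq hμ hn hr, hu.linSys_iff hμ hn hr⟩
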